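/- **Metric graphs.** Let $G$ be a finite connected multigraph (loops and multiple edges allowed) with vertex set $V$, edge set $E$ and edge lengths $\ell(e)>0$. Gluing segments of lengths $\ell(e)$ according to $G$ gives a metric graph $\Gamma$, and $G$ is called a model of $\Gamma$. Write $e^-,e^+$ for the endpoints of an edge $e$ (for some orientation), $\ell(\Gamma)=\sum_e\ell(e)$ for the total length, $dx$ for Lebesgue measure on $\Gamma$, and $v(p)$ for the valence of $p\in\Gamma$ (the number of tangent directions at $p$). $\Gamma$ is *irreducible* if deleting any single point does not disconnect it. It is *cubic* if it has a point of valence $3$ and all its points have valence $2$ or $3$; its *canonical model* is then the model whose vertices are exactly the points of valence $3$. **Polarized metric graphs.** A pm-graph $(\Gamma,q)$ is a metric graph $\Gamma$ with a finitely supported $q:\Gamma\to\mathbb Z_{\ge0}$ such that the canonical divisor $K=\sum_p K(p)[p]$, $K(p)=2q(p)+v(p)-2$, is effective; models of $(\Gamma,q)$ are required to contain the support of $q$ among their vertices. Its genus is $g=\dim H^1(\Gamma,\mathbb R)+\sum_p q(p)$. For a divisor $D=\sum n_p[p]$ put $f(D)=\sum n_pf(p)$. **The invariant $\varphi$.** For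 a continuous function $f$ on $\Gamma$ that is $C^2$ outside a finite set containing the vertices, with $f''\in L^2(dx)$, put $\Delta f=-f''\,dx-\sum_p\sigma_p(f)\delta_p$, where $\sigma_p(f)$ is the sum of the outward derivatives of $f$ at $p$ in all tangent directions. The effective resistance is $r(y,z)=f(y)$, where $f$ is the unique solution of $\Delta f=\delta_y-\delta_z$, $f(z)=0$. The Green's function $g_\nu$ of a signed Borel measure $\nu$ of total mass $1$ is the continuous symmetric function on $\Gamma\times\Gamma$ with $\Delta_xg_\nu(x,y)=\delta_y-\nu$ and $\int g_\nu(x,y)\,d\nu(x)=0$ for every $y$. The admissible measure $\mu$ is the unique signed Borel measure of total mass $1$ for which $g_\mu(x,x)+g_\mu(x,K)$ is constant in $x$. For $g\ge1$ put $$\epsilon=\int r(K,y)\,d\mu(y),\qquad \tau=\tfrac12\iint r(x,y)\,d\mu(x)\,d\mu(y),\qquad \varphi(\Gamma)=3g\tau-\tfrac14\bigl(\epsilon+\ell(\Gamma)\bigr).$$ **The functions $\eta$ and $\omega_1$.** For a model $G$ with edges $e_1,\dots,e_m$ of lengths $\ell_1,\dots,\ell_m$, put $\eta=\sum_T\prod_{e_k\notin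 T}\ell_k$, the sum running over all spanning trees $T$ of $G$. With $R(u,v)=\eta\, r(u,v)$ for vertices $u,v$ and $d_k=\eta-R(e_k^-,e_k^+)/\ell_k$, put, for $g\ge2$, $$\begin{aligned}\omega_1={}&\frac{5g-2}{12g}\Bigl[\ell(\Gamma)\eta^2-\sum_k d_k^2\ell_k\Bigr]+\frac{\eta}{8g(g-1)}\sum_{u,v\in V}K(u)R(u,v)\bigl(3gK(v)-2(5g-2)q(v)\bigr)\\&-\frac{5g-2}{8g(g-1)}\sum_{u\in V}K(u)\sum_k d_k\bigl(R(u,e_k^-)+R(u,e_k^+)\bigr).\end{aligned}$$ **Proposition.** Let $(\Gamma,0)$ be an irreducible cubic pm-graph of genus $g\ge2$ (with $q\equiv0$), let $e_1,\dots,e_m$ be the edges of its canonical model, of lengths $\ell_1,\dots,\ell_m$, and form $\eta$ and $\omega_1$ with respect to this model. Let $\sigma_2,\sigma_3$ be the second and third elementary symmetric polynomials in $\ell_1,\dots,\ell_m$. If $A>0$ is a constant such that $$\frac{\omega_1}{\eta^2}\le A\,\frac{\sigma_3}{\sigma_2},$$ then $$\varphi(\Gamma)\ \ge\ \left[\frac{g-1}{6g}-A\,\frac{3g-5}{9(g-1)}\right]\ell(\Gamma).$$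 -/

import Mathlib

open MeasureTheory

/-- A finite connected multigraph (loops and multiple edges allowed) with positive edge lengths.
Every edge carries an auxiliary orientation from `src` to `tgt`. -/
structure WeightedGraph (V E : Type*) where
  src : E → V
  tgt : E → V
  length : E → ℝ
  length_pos : ∀ e, 0 < length e
  nonempty : Nonempty V
  connected : ∀ u v, Relation.EqvGen (fun a b => ∃ e, src e = a ∧ tgt e = b) u v

namespace WeightedGraph

variable {V E : Type*}

/-- The points of the metric graph `Γ` obtained by realizing `G`: the vertices, and for each edge
`e` a point at distance `t` from `src e` for every `0 < t < length e`. -/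
inductive Point (G : WeightedGraph V E)
  | vert (v : V) : Point G
  | inner (e : E) (t : ℝ) (h : 0 < t ∧ t < G.length e) : Point G

open scoped Classical in
/-- The parametrization by arc length of the segment `e`, from `src e` at `t = 0` to `tgt e` at
`t = length e` (and constant outside `[0, length e]`). -/
noncomputable def pt (G : WeightedGraph V E) (e : E) (t : ℝ) : G.Point :=
  if h : 0 < t ∧ t < G.length e then .inner e t h
  else if t ≤ 0 then .vert (G.src e) else .vert (G.tgt e)

/-- The topology of `Γ` as a 1-dimensional CW complex: the quotient topology from the segments
(the finest one for which all parametrizations are continuous). -/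
noncomputable instance (G : WeightedGraph V E) : TopologicalSpace G.Point :=
  ⨆ e, TopologicalSpace.coinduced (G.pt e) inferInstance

noncomputable instance (G : WeightedGraph V E) : MeasurableSpace G.Point := borel _

instance (G : WeightedGraph V E) : BorelSpace G.Point := ⟨rfl⟩

/-- `Γ` cannot be disconnected by deleting a single point. -/
def IsIrreducible (G : WeightedGraph V E) : Prop :=
  ∀ p : G.Point, IsPreconnected ({p}ᶜ : Set G.Point)

/-- The cellular coboundary from functions on the vertices to functions on the edges. -/
def coboundary (G : WeightedGraph V E) : (V → ℝ) →ₗ[ℝ] (E → ℝ) where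
  toFun f e := f (G.tgt e) - f (G.src e)
  map_add' f f' := by ext e; simp only [Pi.add_apply]; ring
  map_smul' c f := by ext e; simp only [Pi.smul_apply, smul_eq_mul, RingHom.id_apply]; ring

/-- The first (cellular) cohomology `H¹(Γ, ℝ)`. -/
abbrev H1 (G : WeightedGraph V E) : Type _ := (E → ℝ) ⧸ LinearMap.range G.coboundary

/-- The first Betti number `dim H¹(Γ, ℝ)`. -/
noncomputable def firstBetti (G : WeightedGraph V E) : ℕ := Module.finrank ℝ G.H1

/-- A divisor `∑ n_p [p]` on `Γ`. -/
abbrev Divisor (G : WeightedGraph V E) : Type _ := G.Point →₀ ℤ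

/-- `f(D) = ∑ n_p f(p)`. -/
noncomputable def evalDivisor {G : WeightedGraph V E} (D : G.Divisor) (f : G.Point → ℝ) : ℝ :=
  D.sum fun p n => (n : ℝ) * f p

/-- The second derivative along the edges (given the value `0` at the vertices, which form a null
set). -/
noncomputable def secondDeriv {G : WeightedGraph V E} (f : G.Point → ℝ) : G.Point → ℝ
  | .vert _ => 0
  | .inner e t _ => deriv (deriv (fun s => f (G.pt e s))) t

section Finite

variable [Fintype V] [Fintype E]

open scoped Classical in
/-- The number of edge ends at the vertex `v` (a loop counts twice). -/
noncomputable def vertexValence (G : WeightedGraph V E) (v : V) : ℕ :=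
  (Finset.univ.filter fun e => G.src e = v).card + (Finset.univ.filter fun e => G.tgt e = v).card

/-- The valence of a point of `Γ`. -/
noncomputable def valence (G : WeightedGraph V E) : G.Point → ℕ
  | .vert v => G.vertexValence v
  | .inner _ _ _ => 2

/-- `Γ` has a point of valence 3, and all its points have valence 2 or 3. -/
def IsCubic (G : WeightedGraph V E) : Prop :=
  (∃ p : G.Point, G.valence p = 3) ∧ ∀ p : G.Point, G.valence p = 2 ∨ G.valence p = 3

/-- `G` is the canonical model of its cubic metric graph `Γ`: the vertices are exactly the points
of valence 3. -/
def IsCanonicalModel (G : WeightedGraph V E) : Prop :=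
  ∀ p : G.Point, (∃ v, p = .vert v) ↔ G.valence p = 3

noncomputable def totalLength (G : WeightedGraph V E) : ℝ := ∑ e, G.length e

/-- The Lebesgue measure `dx` on `Γ`. -/
noncomputable def lebesgue (G : WeightedGraph V E) : Measure G.Point :=
  ∑ e, (volume.restrict (Set.Ioo 0 (G.length e))).map (G.pt e)

/-- The domain of the Laplacian: continuous functions which are `C²` outside a finite set
containing the vertices, with square-integrable second derivative. -/
def IsPiecewiseC2 {G : WeightedGraph V E} (f : G.Point → ℝ) : Prop :=
  Continuous f ∧
  (∃ S : Set G.Point, S.Finite ∧ ∀ e t, 0 < t → t < G.length e → G.pt e t ∉ S →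
    ContDiffAt ℝ 2 (fun s => f (G.pt e s)) t) ∧
  MemLp (secondDeriv f) 2 G.lebesgue

open scoped Classical in
/-- `σ_p(f)`: the sum over all tangent directions at `p` of the outward derivatives of `f`. -/
noncomputable def slopeSum {G : WeightedGraph V E} (f : G.Point → ℝ) : G.Point → ℝ
  | .vert v =>
      (∑ e with G.src e = v, derivWithin (fun s => f (G.pt e s)) (Set.Ici 0) 0) +
      ∑ e with G.tgt e = v,
        -derivWithin (fun s => f (G.pt e s)) (Set.Iic (G.length e)) (G.length e)
  | .inner e t _ =>
      derivWithin (fun s => f (G.pt e s)) (Set.Ici t) t -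
        derivWithin (fun s => f (G.pt e s)) (Set.Iic t) t

/-- The measure-valued Laplacian `Δ f = - f'' dx - ∑ p, σ_p(f) δ_p`. -/
noncomputable def laplacian {G : WeightedGraph V E} (f : G.Point → ℝ) : SignedMeasure G.Point :=
  -(G.lebesgue.withDensityᵥ (secondDeriv f)) - ∑ᶠ p, VectorMeasure.dirac p (slopeSum f p)

/-- `f` is a Green's function with respect to the signed Borel measure `ν`. -/
structure IsGreen {G : WeightedGraph V E} (ν : SignedMeasure G.Point)
    (gr : G.Point → G.Point → ℝ) : Prop where
  continuous : Continuous fun p : G.Point × G.Point => gr p.1 p.2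
  symm : ∀ x y, gr x y = gr y x
  domain : ∀ y, IsPiecewiseC2 fun x => gr x y
  laplacian_eq : ∀ y, laplacian (fun x => gr x y) = VectorMeasure.dirac y 1 - ν
  integral_eq_zero : ∀ y, ∫ᵛ x, gr x y ∂•ν = 0

/-- `ν` has total mass 1, and its Green's function satisfies `g(x, x) + g(x, D) = a` for all `x`
and some constant `a`. -/
def IsAdmissible {G : WeightedGraph V E} (D : G.Divisor) (ν : SignedMeasure G.Point) : Prop :=
  ν Set.univ = 1 ∧ ∃ gr, IsGreen ν gr ∧ ∃ a : ℝ, ∀ x, gr x x + evalDivisor D (gr x) = a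

/-- The admissible measure `μ_D` (the unique measure with this property if `deg D ≠ -2`). -/
noncomputable def admissibleMeasure {G : WeightedGraph V E} (D : G.Divisor) :
    SignedMeasure G.Point :=
  Classical.epsilon (IsAdmissible D)

/-- `f` solves `Δ f = δ_y - δ_z`, `f(z) = 0`. -/
def IsPotential {G : WeightedGraph V E} (z y : G.Point) (f : G.Point → ℝ) : Prop :=
  IsPiecewiseC2 f ∧ laplacian f = VectorMeasure.dirac y 1 - VectorMeasure.dirac z 1 ∧ f z = 0

/-- The fundamental solution `j_z(·, y)`: the unique function with the above property. -/
noncomputable def potential {G : WeightedGraph V E} (z y : G.Point) : G.Point → ℝ :=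
  Classical.epsilon (IsPotential z y)

/-- The effective resistance `r(y, z) = j_z(y, y)`. -/
noncomputable def resistance {G : WeightedGraph V E} (y z : G.Point) : ℝ := potential z y y

/-- Any two vertices are joined by a path with edges in `T`. -/
def ConnectedBy (G : WeightedGraph V E) (T : Finset E) : Prop :=
  ∀ u v, Relation.EqvGen (fun a b => ∃ e ∈ T, G.src e = a ∧ G.tgt e = b) u v

open scoped Classical in
/-- `T` is the edge set of a spanning tree: it connects all vertices, and it is acyclic, i.e. every
edge of `T` is a bridge of `T`. -/
def IsSpanningTree (G : WeightedGraph V E) (T : Finset E) : Prop :=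
  G.ConnectedBy T ∧ ∀ e ∈ T, ¬ G.ConnectedBy (T.erase e)

open scoped Classical in
/-- `η = ∑_T ∏_{e ∉ T} ℓ(e)`, the sum running over all spanning trees `T`. -/
noncomputable def eta (G : WeightedGraph V E) : ℝ :=
  ∑ T : Finset E with G.IsSpanningTree T, ∏ e ∈ Tᶜ, G.length e

/-- The `k`-th elementary symmetric polynomial in the edge lengths. -/
noncomputable def sigma (G : WeightedGraph V E) (k : ℕ) : ℝ :=
  MvPolynomial.eval G.length (MvPolynomial.esymm E ℝ k)

/-- `R(u, v) = η · r(u, v)` for vertices `u`, `v`. -/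
noncomputable def etaResistance (G : WeightedGraph V E) (u v : V) : ℝ :=
  G.eta * resistance (G := G) (.vert u) (.vert v)

end Finite

end WeightedGraph

/-- A polarized metric graph, given by a model whose vertex set contains the support of the
weight function `q` (so `q` vanishes at all points that are not vertices). -/
structure PMGraph (V E : Type*) [Fintype V] [Fintype E] extends WeightedGraph V E where
  q : V → ℕ
  /-- The canonical divisor is effective. -/
  effective : ∀ v, (0 : ℤ) ≤ 2 * (q v : ℤ) + (toWeightedGraph.vertexValence v : ℤ) - 2

namespace PMGraph

variable {V E : Type*} [Fintype V] [Fintype E]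

/-- `K(v) = 2 q(v) + val(v) - 2`. -/
noncomputable def canonicalCoeff (Γ : PMGraph V E) (v : V) : ℤ :=
  2 * (Γ.q v : ℤ) + (Γ.vertexValence v : ℤ) - 2

/-- The canonical divisor `K = ∑ p, (2 q(p) + val(p) - 2) [p]`; points that are not vertices have
valence 2 and weight 0, and do not contribute. -/
noncomputable def canonicalDivisor (Γ : PMGraph V E) : Γ.Divisor :=
  ∑ v, Finsupp.single (.vert v) (Γ.canonicalCoeff v)

/-- The genus `dim H¹(Γ, ℝ) + ∑ q(p)`. -/
noncomputable def genus (Γ : PMGraph V E) : ℕ := Γ.firstBetti + ∑ v, Γ.q v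

/-- `μ = μ_K`. -/
noncomputable def mu (Γ : PMGraph V E) : SignedMeasure Γ.Point :=
  WeightedGraph.admissibleMeasure Γ.canonicalDivisor

/-- `ε(Γ) = ∬ r(x, y) δ_K(x) dμ(y)`. -/
noncomputable def epsilonInv (Γ : PMGraph V E) : ℝ :=
  ∫ᵛ y, WeightedGraph.evalDivisor Γ.canonicalDivisor
    (fun x => WeightedGraph.resistance x y) ∂•Γ.mu

/-- `τ(Γ) = (1/2) ∬ r(x, y) dμ(x) dμ(y)`. -/
noncomputable def tauInv (Γ : PMGraph V E) : ℝ :=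
  1 / 2 * ∫ᵛ y, (∫ᵛ x, WeightedGraph.resistance x y ∂•Γ.mu) ∂•Γ.mu

/-- `φ(Γ) = 3 g τ(Γ) - (ε(Γ) + ℓ(Γ)) / 4`. -/
noncomputable def phi (Γ : PMGraph V E) : ℝ :=
  3 * (Γ.genus : ℝ) * Γ.tauInv - 1 / 4 * (Γ.epsilonInv + Γ.totalLength)

/-- The value at the edge lengths of the polynomial `ω₁` attached to the model. -/
noncomputable def omega1 (Γ : PMGraph V E) : ℝ :=
  let g : ℝ := Γ.genus
  let K : V → ℝ := fun v => Γ.canonicalCoeff v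
  let R : V → V → ℝ := Γ.etaResistance
  let d : E → ℝ := fun e => Γ.eta - R (Γ.src e) (Γ.tgt e) / Γ.length e
  (5 * g - 2) / (12 * g) * (Γ.totalLength * Γ.eta ^ 2 - ∑ e, d e ^ 2 * Γ.length e)
    + Γ.eta / (8 * g * (g - 1)) *
        ∑ u, ∑ v, K u * R u v * (3 * g * K v - 2 * (5 * g - 2) * (Γ.q v : ℝ))
    - (5 * g - 2) / (8 * g * (g - 1)) *
        ∑ u, K u * ∑ e, d e * (R u (Γ.src e) + R u (Γ.tgt e))

end PMGraph

/-! ### Topology of the realization and Lebesgue measure on its edges. -/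

namespace WeightedGraph

open Set Filter Topology

variable {V E : Type*} {G : WeightedGraph V E}

/-! The theorem splits into an exact identity and an elementary inequality. For $q=0$ one has
$\varphi=\frac{g-1}{6g}\ell(\Gamma)-\omega_1/\eta^2$ (`PMGraph.phi_eq`), so the assumed bound leaves
only $\sigma_3/\sigma_2\le\frac{m-2}{3m}\ell(\Gamma)$ (`card_mul_sigma_three_le`). Trivalence gives
$m=3g-3$, which turns the coefficient into $\frac{3g-5}{9(g-1)}$.

The identity requires everything defined by a differential equation or by choice to become explicit.
Invert the discrete Laplacian up to constants, interpolate bilinearly, and add the Dirichlet Green's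
function of each open edge. The resulting `greenKernel` $k$ is a Green's function, up to
normalization, of the uniform measure on the vertices. Since $\Delta f=0$ forces $f$ to be constant
(`eq_of_laplacian_eq_zero`), effective resistance is $k(y,y)+k(z,z)-2k(y,z)$ (`resistance_eq`).

With $F_e=1-r(e^-,e^+)/\ell_e$, Foster's formula gives $\sum_eF_e=g$, and the admissible measure is
$\mu=\frac1g\sum_e\frac{F_e}{\ell_e}\,dx$ without atoms (`admissibleMeasure_canonical`). Existence
follows by correcting $k$ with a potential $H$ satisfying $2gH(x)=k(x,x)+k(x,K)$; uniqueness holds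
because resistances alone determine $g_\mu(x,x)$ up to a constant.

Integrating $r(\cdot,v)$ over edges yields $\epsilon$ (`edgeIntegral_kernelResistance`). Integrating
the admissibility equation yields $8g(g-1)\tau=(4g-2)\epsilon-\theta$ with
$\theta=\sum_{u,v}K(u)K(v)r(u,v)$ (`integral_kernelResistance`). Substituting into
$3g\tau-\frac14(\epsilon+\ell(\Gamma))$ produces the terms of $\omega_1/\eta^2$. -/

theorem pt_of_nonpos (e : E) {t : ℝ} (ht : t ≤ 0) : G.pt e t = .vert (G.src e) := by
  simp [pt, ht, not_lt.2 ht]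

theorem pt_of_length_le (e : E) {t : ℝ} (ht : G.length e ≤ t) : G.pt e t = .vert (G.tgt e) := by
  have := G.length_pos e
  rw [pt, dif_neg (by intro h; linarith [h.2]), if_neg (by linarith)]

theorem pt_of_mem (e : E) {t : ℝ} (ht : 0 < t ∧ t < G.length e) : G.pt e t = .inner e t ht := by
  simp [pt, ht]

@[simp] theorem pt_zero (e : E) : G.pt e 0 = .vert (G.src e) := pt_of_nonpos e le_rfl

@[simp] theorem pt_length (e : E) : G.pt e (G.length e) = .vert (G.tgt e) := pt_of_length_le e le_rfl

theorem continuous_pt (e : E) : Continuous (G.pt e) :=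
  continuous_iff_coinduced_le.2 (le_iSup (fun e => TopologicalSpace.coinduced (G.pt e) _) e)

theorem continuous_iff_comp_pt {X : Type*} [TopologicalSpace X] {f : G.Point → X} :
    Continuous f ↔ ∀ e, Continuous fun t => f (G.pt e t) := by
  rw [show Continuous f ↔ _ from continuous_iSup_dom]
  exact forall_congr' fun e => continuous_coinduced_dom

theorem isOpen_iff_preimage_pt {U : Set G.Point} : IsOpen U ↔ ∀ e, IsOpen (G.pt e ⁻¹' U) := by
  rw [show IsOpen U ↔ _ from isOpen_iSup_iff]
  exact forall_congr' fun e => isOpen_coinduced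

theorem isClosed_iff_preimage_pt {U : Set G.Point} :
    IsClosed U ↔ ∀ e, IsClosed (G.pt e ⁻¹' U) := by
  simp only [← isOpen_compl_iff, isOpen_iff_preimage_pt, preimage_compl]

theorem pt_mem_cases (e : E) (t : ℝ) :
    (t ≤ 0 ∧ G.pt e t = .vert (G.src e)) ∨ (G.length e ≤ t ∧ G.pt e t = .vert (G.tgt e)) ∨
      ∃ h : 0 < t ∧ t < G.length e, G.pt e t = .inner e t h := by
  by_cases h0 : t ≤ 0
  · exact .inl ⟨h0, pt_of_nonpos e h0⟩
  by_cases h1 : G.length e ≤ t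
  · exact .inr (.inl ⟨h1, pt_of_length_le e h1⟩)
  · exact .inr (.inr ⟨⟨not_le.1 h0, not_le.1 h1⟩, pt_of_mem e _⟩)

/-- Each parametrization meets a point in a closed ray, a union of two such rays, a single parameter
or nothing. The separation property makes points Borel, so that atoms of the Laplacian can be read
off. -/
instance : T1Space G.Point := by
  classical
  refine ⟨fun p => isClosed_iff_preimage_pt.2 fun e => ?_⟩
  have hl := G.length_pos e
  cases p with
  | vert v =>
    have : G.pt e ⁻¹' {.vert v} = (if G.src e = v then Iic 0 else ∅) ∪
        (if G.tgt e = v then Ici (G.length e) else ∅) := by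
      ext t
      rcases G.pt_mem_cases e t with ⟨h, h'⟩ | ⟨h, h'⟩ | ⟨h, h'⟩
      · have : ¬ G.length e ≤ t := by linarith
        split_ifs <;> simp_all
      · have : ¬ t ≤ 0 := by linarith
        split_ifs <;> simp_all
      · have h1 : ¬ t ≤ 0 := by linarith [h.1]
        have h2 : ¬ G.length e ≤ t := by linarith [h.2]
        split_ifs <;> simp_all
    rw [this]
    refine IsClosed.union ?_ ?_
    · split_ifs
      exacts [isClosed_Iic, isClosed_empty]
    · split_ifs
      exacts [isClosed_Ici, isClosed_empty]
  | inner e' s hs =>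
    have : G.pt e ⁻¹' {.inner e' s hs} = if e = e' then {s} else ∅ := by
      ext t
      rcases G.pt_mem_cases e t with ⟨h, h'⟩ | ⟨h, h'⟩ | ⟨h, h'⟩
      · have : e = e' → t ≠ s := by rintro rfl rfl; linarith [hs.1]
        split_ifs <;> simp_all
      · have : e = e' → t ≠ s := by rintro rfl rfl; linarith [hs.2]
        split_ifs <;> simp_all
      · split_ifs <;> simp_all
    rw [this]
    split_ifs
    exacts [isClosed_singleton, isClosed_empty]

theorem injOn_pt (e : E) : InjOn (G.pt e) (Ioo 0 (G.length e)) := by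
  intro s hs t ht h
  rw [pt_of_mem e hs, pt_of_mem e ht] at h
  injection h

/-- Lebesgue measure on the edge `e`. -/
noncomputable def edgeMeasure (G : WeightedGraph V E) (e : E) : Measure G.Point :=
  (volume.restrict (Ioo 0 (G.length e))).map (G.pt e)

instance (e : E) : IsFiniteMeasure (G.edgeMeasure e) := by
  have : IsFiniteMeasure (volume.restrict (Ioo 0 (G.length e))) :=
    ⟨by simp⟩
  unfold edgeMeasure; infer_instance

theorem edgeMeasure_singleton (e : E) (p : G.Point) : G.edgeMeasure e {p} = 0 := by
  rw [edgeMeasure, Measure.map_apply (continuous_pt e).measurable (measurableSet_singleton p),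
    Measure.restrict_apply ((continuous_pt e).measurable (measurableSet_singleton p))]
  refine Set.Subsingleton.measure_zero (fun s hs t ht => injOn_pt e hs.2 ht.2 ?_) _
  exact hs.1.trans ht.1.symm

instance (e : E) : NullSingletonClass (G.edgeMeasure e) := ⟨edgeMeasure_singleton e⟩

theorem edgeMeasure_eventually {e : E} {P : G.Point → Prop} {S : Set G.Point} (hS : S.Finite)
    (h : ∀ t (ht : 0 < t ∧ t < G.length e), .inner e t ht ∉ S → P (.inner e t ht)) :
    ∀ᵐ x ∂G.edgeMeasure e, P x := by
  -- The open edge is open in the quotient topology, hence Borel; this allows the pushforward to be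
  -- tested on it.
  have hopen : IsOpen (G.pt e '' Ioo 0 (G.length e)) := by
    classical
    refine isOpen_iff_preimage_pt.2 fun e' => ?_
    have : G.pt e' ⁻¹' (G.pt e '' Ioo 0 (G.length e)) =
        if e' = e then Ioo 0 (G.length e) else ∅ := by
      ext t
      simp only [mem_preimage, mem_image]
      constructor
      · rintro ⟨s, hs, h⟩
        rw [pt_of_mem e hs] at h
        rcases G.pt_mem_cases e' t with ⟨h1, h'⟩ | ⟨h1, h'⟩ | ⟨h1, h'⟩ <;> rw [h'] at h
        · simp at h
        · simp at h
        · injection h with h2 h3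
          subst h2
          simpa using h1
      · split_ifs with hh
        · subst hh
          exact fun h => ⟨t, h, rfl⟩
        · simp
    rw [this]
    split_ifs
    exacts [isOpen_Ioo, isOpen_empty]
  have h1 : ∀ᵐ x ∂G.edgeMeasure e, x ∈ G.pt e '' Ioo 0 (G.length e) := by
    refine (ae_map_iff (continuous_pt e).measurable.aemeasurable hopen.measurableSet).2 ?_
    filter_upwards [ae_restrict_mem measurableSet_Ioo] with t ht using mem_image_of_mem _ ht
  have h2 : ∀ᵐ x ∂G.edgeMeasure e, x ∉ S := by
    have := hS.measure_zero (G.edgeMeasure e)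
    simpa [ae_iff] using this
  filter_upwards [h1, h2] with x hx hxS
  obtain ⟨t, ht, rfl⟩ := hx
  rw [pt_of_mem e ht] at hxS ⊢
  exact h t ht hxS

theorem integral_edgeMeasure {f : G.Point → ℝ} (hf : Continuous f) (e : E) :
    ∫ x, f x ∂G.edgeMeasure e = ∫ t in (0 : ℝ)..G.length e, f (G.pt e t) := by
  rw [edgeMeasure, integral_map (continuous_pt e).measurable.aemeasurable
    hf.measurable.aestronglyMeasurable, intervalIntegral.integral_of_le (G.length_pos e).le,
    integral_Ioc_eq_integral_Ioo]

theorem integrable_edgeMeasure {f : G.Point → ℝ} (hf : Continuous f) (e : E) :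
    Integrable f (G.edgeMeasure e) := by
  rw [edgeMeasure, integrable_map_measure hf.measurable.aestronglyMeasurable
    (continuous_pt e).measurable.aemeasurable]
  have : Continuous (f ∘ G.pt e) := hf.comp (continuous_pt e)
  exact (this.continuousOn.integrableOn_compact isCompact_Icc).mono_set Ioo_subset_Icc_self

theorem edgeMeasure_univ (e : E) : (G.edgeMeasure e).real univ = G.length e := by
  rw [edgeMeasure, Measure.real, Measure.map_apply (continuous_pt e).measurable .univ]
  simp [(G.length_pos e).le]

section Finite

variable [Fintype E]

theorem lebesgue_eq_sum : G.lebesgue = ∑ e, G.edgeMeasure e := rfl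

instance : IsFiniteMeasure G.lebesgue := by
  rw [lebesgue_eq_sum]; infer_instance

theorem edgeMeasure_le_lebesgue (e : E) : G.edgeMeasure e ≤ G.lebesgue := by
  classical
  rw [lebesgue_eq_sum, ← Finset.add_sum_erase _ _ (Finset.mem_univ e)]
  exact Measure.le_add_right le_rfl

theorem lebesgue_singleton (p : G.Point) : G.lebesgue {p} = 0 := by
  simp [lebesgue_eq_sum]

instance : NullSingletonClass G.lebesgue := ⟨lebesgue_singleton⟩

theorem ae_lebesgue_iff {P : G.Point → Prop} :
    (∀ᵐ x ∂G.lebesgue, P x) ↔ ∀ e, ∀ᵐ x ∂G.edgeMeasure e, P x := by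
  simp [ae_iff, lebesgue_eq_sum]

theorem lebesgue_eventually {P : G.Point → Prop} {S : Set G.Point} (hS : S.Finite)
    (h : ∀ e t (ht : 0 < t ∧ t < G.length e), .inner e t ht ∉ S → P (.inner e t ht)) :
    ∀ᵐ x ∂G.lebesgue, P x :=
  ae_lebesgue_iff.2 fun e => edgeMeasure_eventually hS (h e)

/-- The signed measure `∑ e, c e · dx` with constant density on each edge. -/
noncomputable def edgeDensity (G : WeightedGraph V E) (c : E → ℝ) : SignedMeasure G.Point :=
  ∑ e, c e • (G.edgeMeasure e).toSignedMeasure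

theorem edgeDensity_apply (c : E → ℝ) {A : Set G.Point} (hA : MeasurableSet A) :
    G.edgeDensity c A = ∑ e, c e * (G.edgeMeasure e).real A := by
  simp [edgeDensity, Measure.toSignedMeasure_apply_measurable hA]

/-- No measurability of `h` is assumed: it follows from a.e. agreement with a constant on each edge.
-/
theorem memLp_of_edge_constant {h : G.Point → ℝ} {S : Set G.Point} (hS : S.Finite) {c : E → ℝ}
    (hc : ∀ e t (ht : 0 < t ∧ t < G.length e), .inner e t ht ∉ S → h (.inner e t ht) = c e) :
    MemLp h 2 G.lebesgue := by
  have key : ∀ e, h =ᵐ[G.edgeMeasure e] fun _ => c e := fun e =>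
    edgeMeasure_eventually hS (hc e)
  have hm : AEStronglyMeasurable h G.lebesgue := by
    rw [lebesgue_eq_sum, ← Measure.sum_fintype, aestronglyMeasurable_sum_measure_iff]
    exact fun e => (aestronglyMeasurable_const).congr (key e).symm
  refine MemLp.of_bound hm (∑ e, |c e|) (ae_lebesgue_iff.2 fun e => ?_)
  filter_upwards [key e] with x hx
  rw [hx]
  exact Finset.single_le_sum (f := fun e => |c e|) (fun _ _ => abs_nonneg _) (Finset.mem_univ e)

theorem withDensityᵥ_of_edge_constant {h : G.Point → ℝ} {S : Set G.Point} (hS : S.Finite)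
    {c : E → ℝ}
    (hc : ∀ e t (ht : 0 < t ∧ t < G.length e), .inner e t ht ∉ S → h (.inner e t ht) = c e) :
    G.lebesgue.withDensityᵥ h = G.edgeDensity c := by
  have key : ∀ e, h =ᵐ[G.edgeMeasure e] fun _ => c e := fun e =>
    edgeMeasure_eventually hS (hc e)
  have hint : Integrable h G.lebesgue :=
    (memLp_of_edge_constant hS hc).integrable (by norm_num)
  ext A hA
  have hsum : G.lebesgue.restrict A = ∑ e, (G.edgeMeasure e).restrict A := by
    rw [lebesgue_eq_sum, ← Measure.sum_fintype, Measure.restrict_sum _ hA, Measure.sum_fintype]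
  rw [withDensityᵥ_apply hint hA, edgeDensity_apply c hA, hsum, integral_finsetSum_measure]
  · refine Finset.sum_congr rfl fun e _ => ?_
    rw [integral_congr_ae (ae_restrict_of_ae (key e))]
    simp [mul_comm]
  · intro e _
    exact (hint.mono_measure (edgeMeasure_le_lebesgue e)).integrableOn

theorem integral_edgeDensity {f : G.Point → ℝ} (hf : Continuous f) (c : E → ℝ) :
    ∫ᵛ x, f x ∂•(G.edgeDensity c) = ∑ e, c e * ∫ t in (0 : ℝ)..G.length e, f (G.pt e t) := by
  rw [edgeDensity, VectorMeasure.integral_finsetSum_vectorMeasure]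
  · refine Finset.sum_congr rfl fun e _ => ?_
    -- Scalar multiplication on ℝ is symmetric, so the pairing may be flipped to match
    -- `VectorMeasure.integral_toSignedMeasure`.
    have hflip : ContinuousLinearMap.lsmul ℝ ℝ =
        (ContinuousLinearMap.lsmul ℝ ℝ : ℝ →L[ℝ] ℝ →L[ℝ] ℝ).flip := by
      ext; simp
    rw [VectorMeasure.integral_smul_vectorMeasure, ← integral_edgeMeasure hf, hflip,
      VectorMeasure.integral_toSignedMeasure, smul_eq_mul]
  · intro e _
    apply VectorMeasure.Integrable.smul_vectorMeasure
    rw [VectorMeasure.Integrable, Measure.variation_toSignedMeasure]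
    exact integrable_edgeMeasure hf e

end Finite

end WeightedGraph

/-! ### One-sided derivatives of functions with integrable second derivative. -/

section OneVariable

open Set Filter Topology

theorem ContDiffAt.differentiableAt_deriv {φ : ℝ → ℝ} {t : ℝ} (h : ContDiffAt ℝ 2 φ t) :
    DifferentiableAt ℝ (deriv φ) t :=
  (ContDiffAt.derivWithin (m := 1) h (by norm_num)).differentiableAt (by norm_num)

/-- The first derivative is a primitive of an integrable function, and such a primitive extends
continuously to both endpoints. -/
theorem exists_continuousOn_eq_deriv {φ : ℝ → ℝ} {a b : ℝ} (hab : a < b)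
    (hC : ∀ t ∈ Ioo a b, ContDiffAt ℝ 2 φ t)
    (hint : IntegrableOn (deriv (deriv φ)) (Ioo a b)) :
    ∃ ψ : ℝ → ℝ, ContinuousOn ψ (Icc a b) ∧ ∀ t ∈ Ioo a b, deriv φ t = ψ t := by
  set c := (a + b) / 2
  have hc : c ∈ Ioo a b := ⟨by simp only [c]; linarith, by simp only [c]; linarith⟩
  have hI : IntervalIntegrable (deriv (deriv φ)) volume a b := by
    rw [intervalIntegrable_iff_integrableOn_Ioc_of_le hab.le, integrableOn_Ioc_iff_integrableOn_Ioo]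
    exact hint
  refine ⟨fun t => deriv φ c + ∫ s in c..t, deriv (deriv φ) s, ?_, fun t ht => ?_⟩
  · have := intervalIntegral.continuousOn_primitive_interval' hI (a := c)
      (by rw [uIcc_of_le hab.le]; exact Ioo_subset_Icc_self hc)
    rw [uIcc_of_le hab.le] at this
    exact continuousOn_const.add this
  · have hsub : uIcc c t ⊆ Ioo a b := by
      intro s hs
      rcases le_total c t with h | h
      · rw [uIcc_of_le h] at hs
        exact ⟨hc.1.trans_le hs.1, hs.2.trans_lt ht.2⟩
      · rw [uIcc_of_ge h] at hs
        exact ⟨ht.1.trans_le hs.1, hs.2.trans_lt hc.2⟩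
    have hd : ∀ s ∈ uIcc c t, HasDerivAt (deriv φ) (deriv (deriv φ) s) s := fun s hs =>
      (hC s (hsub hs)).differentiableAt_deriv.hasDerivAt
    change _ = deriv φ c + ∫ s in c..t, deriv (deriv φ) s
    rw [intervalIntegral.integral_eq_sub_of_hasDerivAt hd (hI.mono_set ?_)]
    · ring
    · rw [uIcc_of_le hab.le]
      exact hsub.trans Ioo_subset_Icc_self

/-- Next to `t` there is an interval free of exceptional points, on which the derivative has a limit
at `t`; the limit is then the one-sided derivative. Hence slopes exist everywhere, also at kinks and
vertices, and `derivWithin` never takes its default value there. -/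
theorem exists_hasDerivWithinAt_Ici {φ : ℝ → ℝ} {a b t : ℝ} {T : Set ℝ} (hφ : Continuous φ)
    (hT : T.Finite) (hC : ∀ t ∈ Ioo a b, t ∉ T → ContDiffAt ℝ 2 φ t)
    (hint : IntegrableOn (deriv (deriv φ)) (Ioo a b)) (hat : a ≤ t) (htb : t < b) :
    ∃ d, HasDerivWithinAt φ d (Ici t) t ∧ Tendsto (deriv φ) (𝓝[>] t) (𝓝 d) := by
  have h1 : ∀ᶠ s in 𝓝[>] t, s ∉ T := by
    -- The point `t` is removed from `T` because it may itself be exceptional.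
    have : (T \ {t})ᶜ ∈ 𝓝 t := (hT.subset sdiff_subset).isClosed.isOpen_compl.mem_nhds (by simp)
    filter_upwards [nhdsWithin_le_nhds this, self_mem_nhdsWithin] with s hs hst hsT
    exact hs ⟨hsT, (mem_Ioi.1 hst).ne'⟩
  obtain ⟨u, hu, hus⟩ := mem_nhdsGT_iff_exists_Ioo_subset.1 (h1.and (Ioo_mem_nhdsGT htb))
  have hsub : Ioo t u ⊆ Ioo a b := fun s hs => ⟨hat.trans_lt hs.1, (hus hs).2.2⟩
  have hC' : ∀ s ∈ Ioo t u, ContDiffAt ℝ 2 φ s := fun s hs => hC s (hsub hs) (hus hs).1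
  obtain ⟨ψ, hψ, hd⟩ := exists_continuousOn_eq_deriv hu hC' (hint.mono_set hsub)
  have hlim : Tendsto (deriv φ) (𝓝[>] t) (𝓝 (ψ t)) := by
    have h2 : Tendsto ψ (𝓝[>] t) (𝓝 (ψ t)) := by
      rw [← nhdsWithin_Ioo_eq_nhdsGT hu]
      exact (hψ t ⟨le_rfl, (mem_Ioi.1 hu).le⟩).mono Ioo_subset_Icc_self
    refine h2.congr' ?_
    filter_upwards [Ioo_mem_nhdsGT hu] with s hs using (hd s hs).symm
  exact ⟨ψ t, hasDerivWithinAt_Ici_of_tendsto_deriv (s := Ioo t u)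
    (fun s hs => ((hC' s hs).differentiableAt (by norm_num)).differentiableWithinAt)
    hφ.continuousWithinAt (Ioo_mem_nhdsGT hu) hlim, hlim⟩

theorem exists_hasDerivWithinAt_Iic {φ : ℝ → ℝ} {a b t : ℝ} {T : Set ℝ} (hφ : Continuous φ)
    (hT : T.Finite) (hC : ∀ t ∈ Ioo a b, t ∉ T → ContDiffAt ℝ 2 φ t)
    (hint : IntegrableOn (deriv (deriv φ)) (Ioo a b)) (hat : a < t) (htb : t ≤ b) :
    ∃ d, HasDerivWithinAt φ d (Iic t) t ∧ Tendsto (deriv φ) (𝓝[<] t) (𝓝 d) := by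
  have h1 : ∀ᶠ s in 𝓝[<] t, s ∉ T := by
    have : (T \ {t})ᶜ ∈ 𝓝 t := (hT.subset sdiff_subset).isClosed.isOpen_compl.mem_nhds (by simp)
    filter_upwards [nhdsWithin_le_nhds this, self_mem_nhdsWithin] with s hs hst hsT
    exact hs ⟨hsT, (mem_Iio.1 hst).ne⟩
  obtain ⟨u, hu, hus⟩ := mem_nhdsLT_iff_exists_Ioo_subset.1 (h1.and (Ioo_mem_nhdsLT hat))
  have hsub : Ioo u t ⊆ Ioo a b := fun s hs => ⟨(hus hs).2.1, hs.2.trans_le htb⟩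
  have hC' : ∀ s ∈ Ioo u t, ContDiffAt ℝ 2 φ s := fun s hs => hC s (hsub hs) (hus hs).1
  obtain ⟨ψ, hψ, hd⟩ := exists_continuousOn_eq_deriv hu hC' (hint.mono_set hsub)
  have hlim : Tendsto (deriv φ) (𝓝[<] t) (𝓝 (ψ t)) := by
    have h2 : Tendsto ψ (𝓝[<] t) (𝓝 (ψ t)) := by
      rw [← nhdsWithin_Ioo_eq_nhdsLT hu]
      exact (hψ t ⟨(mem_Iio.1 hu).le, le_rfl⟩).mono Ioo_subset_Icc_self
    refine h2.congr' ?_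
    filter_upwards [Ioo_mem_nhdsLT hu] with s hs using (hd s hs).symm
  exact ⟨ψ t, hasDerivWithinAt_Iic_of_tendsto_deriv (s := Ioo u t)
    (fun s hs => ((hC' s hs).differentiableAt (by norm_num)).differentiableWithinAt)
    hφ.continuousWithinAt (Ioo_mem_nhdsLT hu) hlim, hlim⟩

end OneVariable

/-! ### Linearity of the measure-valued Laplacian. -/

namespace WeightedGraph

open Set Filter Topology

variable {V E : Type*} {G : WeightedGraph V E} {f h : G.Point → ℝ}

theorem dirac_add {X : Type*} [MeasurableSpace X] (x : X) (a b : ℝ) :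
    VectorMeasure.dirac x (a + b) = VectorMeasure.dirac x a + VectorMeasure.dirac x b := by
  ext A hA
  by_cases h : x ∈ A <;> simp [h, hA]

theorem dirac_smul {X : Type*} [MeasurableSpace X] (x : X) (a b : ℝ) :
    VectorMeasure.dirac x (a * b) = a • VectorMeasure.dirac x b := by
  ext A hA
  by_cases h : x ∈ A <;> simp [h, hA]

theorem support_dirac_finite {u : G.Point → ℝ} (hu : (Function.support u).Finite) :
    Function.HasFiniteSupport fun p => (VectorMeasure.dirac p (u p) : SignedMeasure G.Point) := by
  refine hu.subset fun p hp hup => hp ?_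
  simp [hup]

theorem secondDeriv_const_mul (f : G.Point → ℝ) (a : ℝ) :
    secondDeriv (fun x => a * f x) = a • secondDeriv f := by
  ext p
  cases p with
  | vert v => simp [secondDeriv]
  | inner e t ht =>
    simp only [secondDeriv, deriv_const_mul_field', Pi.smul_apply, smul_eq_mul]

theorem secondDeriv_pt (f : G.Point → ℝ) (e : E) {t : ℝ} (ht : t ∈ Ioo 0 (G.length e)) :
    secondDeriv f (G.pt e t) = deriv (deriv fun s => f (G.pt e s)) t := by
  rw [pt_of_mem e ht]; rfl

variable [Fintype E]

namespace IsPiecewiseC2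

theorem comp_pt (hf : IsPiecewiseC2 f) (e : E) : Continuous fun s => f (G.pt e s) :=
  hf.1.comp (continuous_pt e)

theorem integrable_secondDeriv (hf : IsPiecewiseC2 f) : Integrable (secondDeriv f) G.lebesgue :=
  hf.2.2.integrable (by norm_num)

theorem integrableOn_deriv_deriv (hf : IsPiecewiseC2 f) (e : E) :
    IntegrableOn (deriv (deriv fun s => f (G.pt e s))) (Ioo 0 (G.length e)) := by
  have h1 := hf.integrable_secondDeriv.mono_measure (edgeMeasure_le_lebesgue e)
  have h2 : Integrable (secondDeriv f ∘ G.pt e) (volume.restrict (Ioo 0 (G.length e))) :=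
    h1.comp_measurable (continuous_pt e).measurable
  refine h2.congr ?_
  filter_upwards [ae_restrict_mem measurableSet_Ioo] with t ht using secondDeriv_pt f e ht

/-- A finite set of exceptional points on the edge `e`. -/
theorem exists_finite_edge (hf : IsPiecewiseC2 f) (e : E) :
    ∃ T : Set ℝ, T.Finite ∧ ∀ t ∈ Ioo 0 (G.length e), t ∉ T →
      ContDiffAt ℝ 2 (fun s => f (G.pt e s)) t := by
  obtain ⟨S, hS, hC⟩ := hf.2.1
  refine ⟨Ioo 0 (G.length e) ∩ G.pt e ⁻¹' S, ?_, fun t ht htT => hC e t ht.1 ht.2 fun h => htT ⟨ht, h⟩⟩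
  exact Finite.of_finite_image (f := G.pt e) (hS.subset (by rintro _ ⟨t, ht, rfl⟩; exact ht.2))
    ((injOn_pt e).mono inter_subset_left)

theorem hasDerivWithinAt_Ici (hf : IsPiecewiseC2 f) (e : E) {t : ℝ} (h0 : 0 ≤ t)
    (h1 : t < G.length e) : ∃ d, HasDerivWithinAt (fun s => f (G.pt e s)) d (Ici t) t ∧
      Tendsto (deriv fun s => f (G.pt e s)) (𝓝[>] t) (𝓝 d) := by
  obtain ⟨T, hT, hC⟩ := hf.exists_finite_edge e
  exact exists_hasDerivWithinAt_Ici (hf.comp_pt e) hT hC (hf.integrableOn_deriv_deriv e) h0 h1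

theorem hasDerivWithinAt_Iic (hf : IsPiecewiseC2 f) (e : E) {t : ℝ} (h0 : 0 < t)
    (h1 : t ≤ G.length e) : ∃ d, HasDerivWithinAt (fun s => f (G.pt e s)) d (Iic t) t ∧
      Tendsto (deriv fun s => f (G.pt e s)) (𝓝[<] t) (𝓝 d) := by
  obtain ⟨T, hT, hC⟩ := hf.exists_finite_edge e
  exact exists_hasDerivWithinAt_Iic (hf.comp_pt e) hT hC (hf.integrableOn_deriv_deriv e) h0 h1

theorem differentiableWithinAt_Ici (hf : IsPiecewiseC2 f) (e : E) {t : ℝ} (h0 : 0 ≤ t)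
    (h1 : t < G.length e) : DifferentiableWithinAt ℝ (fun s => f (G.pt e s)) (Ici t) t :=
  let ⟨_, h, _⟩ := hf.hasDerivWithinAt_Ici e h0 h1
  h.differentiableWithinAt

theorem differentiableWithinAt_Iic (hf : IsPiecewiseC2 f) (e : E) {t : ℝ} (h0 : 0 < t)
    (h1 : t ≤ G.length e) : DifferentiableWithinAt ℝ (fun s => f (G.pt e s)) (Iic t) t :=
  let ⟨_, h, _⟩ := hf.hasDerivWithinAt_Iic e h0 h1
  h.differentiableWithinAt

/-- Off the vertices and the exceptional set the two one-sided derivatives cancel. The finiteness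
makes the `finsum` in `laplacian` a true sum instead of the default 0. -/
theorem slopeSum_finite [Finite V] (hf : IsPiecewiseC2 f) :
    (Function.support (slopeSum f)).Finite := by
  obtain ⟨S, hS, hC⟩ := hf.2.1
  refine ((Set.finite_range (Point.vert (G := G))).union hS).subset fun p hp => ?_
  cases p with
  | vert v => exact .inl ⟨v, rfl⟩
  | inner e t ht =>
    refine .inr (by_contra fun hpS => hp ?_)
    rw [← pt_of_mem e ht] at hpS
    have hd := (hC e t ht.1 ht.2 hpS).differentiableAt (by norm_num)
    rw [slopeSum, hd.derivWithin (uniqueDiffOn_Ici _ _ self_mem_Ici),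
      hd.derivWithin (uniqueDiffOn_Iic _ _ self_mem_Iic), sub_self]

theorem slopeSum_add (hf : IsPiecewiseC2 f) (hh : IsPiecewiseC2 h) (p : G.Point) :
    slopeSum (fun x => f x + h x) p = slopeSum f p + slopeSum h p := by
  have hr : ∀ e t, 0 ≤ t → t < G.length e →
      derivWithin (fun s => f (G.pt e s) + h (G.pt e s)) (Ici t) t =
        derivWithin (fun s => f (G.pt e s)) (Ici t) t +
          derivWithin (fun s => h (G.pt e s)) (Ici t) t := fun e t h0 h1 =>
    derivWithin_fun_add (hf.differentiableWithinAt_Ici e h0 h1) (hh.differentiableWithinAt_Ici e h0 h1)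
  have hl : ∀ e t, 0 < t → t ≤ G.length e →
      derivWithin (fun s => f (G.pt e s) + h (G.pt e s)) (Iic t) t =
        derivWithin (fun s => f (G.pt e s)) (Iic t) t +
          derivWithin (fun s => h (G.pt e s)) (Iic t) t := fun e t h0 h1 =>
    derivWithin_fun_add (hf.differentiableWithinAt_Iic e h0 h1) (hh.differentiableWithinAt_Iic e h0 h1)
  cases p with
  | vert v =>
    simp only [slopeSum, hr _ 0 le_rfl (G.length_pos _), hl _ _ (G.length_pos _) le_rfl, neg_add,
      Finset.sum_add_distrib]
    ring
  | inner e t ht =>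
    simp only [slopeSum, hr e t ht.1.le ht.2, hl e t ht.1 ht.2.le]
    ring

theorem add (hf : IsPiecewiseC2 f) (hh : IsPiecewiseC2 h) :
    IsPiecewiseC2 (fun x => f x + h x) ∧
      secondDeriv (fun x => f x + h x) =ᵐ[G.lebesgue] secondDeriv f + secondDeriv h := by
  obtain ⟨S, hS, hC⟩ := hf.2.1
  obtain ⟨S', hS', hC'⟩ := hh.2.1
  have key : secondDeriv (fun x => f x + h x) =ᵐ[G.lebesgue] secondDeriv f + secondDeriv h := by
    refine lebesgue_eventually (hS.union hS') fun e t ht hnot => ?_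
    rw [← pt_of_mem e ht] at hnot ⊢
    rw [mem_union, not_or] at hnot
    have c1 := hC e t ht.1 ht.2 hnot.1
    have c2 := hC' e t ht.1 ht.2 hnot.2
    rw [Pi.add_apply, secondDeriv_pt _ e ht, secondDeriv_pt _ e ht, secondDeriv_pt _ e ht,
      ← deriv_add c1.differentiableAt_deriv c2.differentiableAt_deriv]
    -- The first derivatives must add on a neighbourhood, which works because `ContDiffAt` at `t`
    -- persists nearby.
    refine Filter.EventuallyEq.deriv_eq ?_
    filter_upwards [c1.eventually (by norm_num), c2.eventually (by norm_num)] with s h1 h2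
    exact deriv_fun_add (h1.differentiableAt (by norm_num)) (h2.differentiableAt (by norm_num))
  refine ⟨⟨hf.1.add hh.1, ⟨S ∪ S', hS.union hS', fun e t h0 h1 hnot => ?_⟩, ?_⟩, key⟩
  · rw [mem_union, not_or] at hnot
    exact (hC e t h0 h1 hnot.1).add (hC' e t h0 h1 hnot.2)
  · exact (memLp_congr_ae key).2 (hf.2.2.add hh.2.2)

end IsPiecewiseC2

theorem laplacian_add [Finite V] (hf : IsPiecewiseC2 f) (hh : IsPiecewiseC2 h) :
    laplacian (fun x => f x + h x) = laplacian f + laplacian h := by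
  simp only [laplacian, hf.slopeSum_add hh, dirac_add]
  rw [finsum_add_distrib (support_dirac_finite hf.slopeSum_finite)
    (support_dirac_finite hh.slopeSum_finite),
    WithDensityᵥEq.congr_ae (hf.add hh).2,
    withDensityᵥ_add hf.integrable_secondDeriv hh.integrable_secondDeriv]
  abel

theorem slopeSum_const_mul (f : G.Point → ℝ) (a : ℝ) (p : G.Point) :
    slopeSum (fun x => a * f x) p = a * slopeSum f p := by
  cases p with
  | vert v =>
    simp only [slopeSum, derivWithin_const_mul_field, mul_add, Finset.mul_sum, mul_neg]
  | inner e t ht =>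
    simp only [slopeSum, derivWithin_const_mul_field, mul_sub]

theorem IsPiecewiseC2.const_mul (hf : IsPiecewiseC2 f) (a : ℝ) :
    IsPiecewiseC2 fun x => a * f x := by
  obtain ⟨S, hS, hC⟩ := hf.2.1
  refine ⟨continuous_const.mul hf.1, ⟨S, hS, fun e t h0 h1 hnot =>
    contDiffAt_const.mul (hC e t h0 h1 hnot)⟩, ?_⟩
  rw [secondDeriv_const_mul]
  exact hf.2.2.const_smul a

theorem laplacian_const_mul [Finite V] (hf : IsPiecewiseC2 f) (a : ℝ) :
    laplacian (fun x => a * f x) = a • laplacian f := by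
  simp only [laplacian, slopeSum_const_mul, secondDeriv_const_mul, dirac_smul]
  rw [← smul_finsum' _ (support_dirac_finite hf.slopeSum_finite), withDensityᵥ_smul, smul_sub,
    smul_neg]

end WeightedGraph

/-! ### The discrete Laplacian and uniqueness of solutions up to constants. -/

namespace WeightedGraph

open Set Filter Topology

theorem eq_of_forall_edge {V E : Type*} {G : WeightedGraph V E} {X : Type*} {a : V → X} (h : ∀ e, a (G.src e) = a (G.tgt e)) (u v : V) :
    a u = a v := by
  induction G.connected u v with
  | rel x y hxy => obtain ⟨e, rfl, rfl⟩ := hxy; exact h e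
  | refl x => rfl
  | symm x y _ ih => exact ih.symm
  | trans x y z _ _ ih1 ih2 => exact ih1.trans ih2

section EndSum

variable {V E : Type*} [Fintype E] (G : WeightedGraph V E)

open scoped Classical in
/-- The sum over all edge ends at `u`, of `α e` at the source and of `β e` at the target of `e`. -/
noncomputable def endSum (α β : E → ℝ) (u : V) : ℝ :=
  (∑ e with G.src e = u, α e) + ∑ e with G.tgt e = u, β e

/-- The discrete Laplacian, with conductances `1 / length e`. -/
noncomputable def graphLap (a : V → ℝ) : V → ℝ :=
  G.endSum (fun e => (a (G.src e) - a (G.tgt e)) / G.length e)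
    fun e => (a (G.tgt e) - a (G.src e)) / G.length e

variable {G}

theorem endSum_add (α β α' β' : E → ℝ) (u : V) :
    G.endSum (fun e => α e + α' e) (fun e => β e + β' e) u =
      G.endSum α β u + G.endSum α' β' u := by
  simp only [endSum, Finset.sum_add_distrib]; ring

theorem endSum_const_mul (c : ℝ) (α β : E → ℝ) (u : V) :
    G.endSum (fun e => c * α e) (fun e => c * β e) u = c * G.endSum α β u := by
  simp only [endSum, ← Finset.mul_sum]; ring

theorem endSum_one (u : V) : G.endSum (fun _ => 1) (fun _ => 1) u = G.vertexValence u := by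
  simp [endSum, vertexValence]

/-- Every edge end lies at exactly one vertex, so a sum over vertices and ends regroups by edges;
loops contribute both ends. -/
theorem sum_mul_endSum [Fintype V] (b : V → ℝ) (α β : E → ℝ) :
    ∑ u, b u * G.endSum α β u = ∑ e, (b (G.src e) * α e + b (G.tgt e) * β e) := by
  classical
  have key : ∀ (s : E → V) (γ : E → ℝ), ∑ u, b u * ∑ e with s e = u, γ e = ∑ e, b (s e) * γ e := by
    intro s γ
    rw [← Finset.sum_fiberwise Finset.univ s]
    refine Finset.sum_congr rfl fun u _ => ?_
    rw [Finset.mul_sum]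
    refine Finset.sum_congr rfl fun e he => ?_
    rw [(Finset.mem_filter.1 he).2]
  simp only [endSum, mul_add, Finset.sum_add_distrib]
  exact congrArg₂ (· + ·) (key _ _) (key _ _)

/-- Discrete Green's identity; its symmetric right side encodes self-adjointness, and `b = a` gives
the energy. -/
theorem sum_mul_graphLap [Fintype V] (a b : V → ℝ) :
    ∑ u, b u * G.graphLap a u =
      ∑ e, (b (G.src e) - b (G.tgt e)) * (a (G.src e) - a (G.tgt e)) / G.length e := by
  rw [graphLap, sum_mul_endSum]
  exact Finset.sum_congr rfl fun e _ => by ring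

theorem eq_of_energy_nonpos {a : V → ℝ}
    (h : ∑ e, (a (G.src e) - a (G.tgt e)) * (a (G.src e) - a (G.tgt e)) / G.length e ≤ 0)
    (u v : V) : a u = a v := by
  have hnn : ∀ e ∈ Finset.univ,
      0 ≤ (a (G.src e) - a (G.tgt e)) * (a (G.src e) - a (G.tgt e)) / G.length e :=
    fun e _ => div_nonneg (mul_self_nonneg _) (G.length_pos e).le
  have h0 := (Finset.sum_eq_zero_iff_of_nonneg hnn).1 (le_antisymm h (Finset.sum_nonneg hnn))
  refine eq_of_forall_edge (G := G) (fun e => ?_) u v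
  have := h0 e (Finset.mem_univ e)
  rw [div_eq_zero_iff, or_iff_left (G.length_pos e).ne', mul_self_eq_zero] at this
  linarith

end EndSum

section Uniqueness

variable {V E : Type*} [Fintype E] {G : WeightedGraph V E} {f h : G.Point → ℝ}

theorem laplacian_singleton [Finite V] (hf : IsPiecewiseC2 f) (p : G.Point) :
    laplacian f {p} = -slopeSum f p := by
  classical
  have h1 : G.lebesgue.withDensityᵥ (secondDeriv f) {p} = 0 := by
    rw [withDensityᵥ_apply hf.integrable_secondDeriv (measurableSet_singleton p),
      setIntegral_measure_zero _ (lebesgue_singleton p)]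
  have h2 : (∑ᶠ q, VectorMeasure.dirac q (slopeSum f q) : SignedMeasure G.Point) {p} =
      slopeSum f p := by
    rw [finsum_eq_sum_of_support_subset (s := insert p hf.slopeSum_finite.toFinset)]
    · rw [_root_.sum_apply]
      rw [Finset.sum_eq_single p]
      · exact VectorMeasure.dirac_apply_of_mem (measurableSet_singleton p) rfl
      · intro q _ hq
        exact VectorMeasure.dirac_apply_of_notMem (by simpa using hq)
      · simp
    · intro q hq
      rw [Finset.coe_insert, Finite.coe_toFinset]
      exact .inr fun h => hq (by simp [h])
  simp [laplacian, h1, h2]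

theorem ae_secondDeriv_eq_zero (hf : IsPiecewiseC2 f) (h0 : laplacian f = 0)
    (hs : ∀ p, slopeSum f p = 0) : secondDeriv f =ᵐ[G.lebesgue] 0 := by
  refine Integrable.ae_eq_of_withDensityᵥ_eq hf.integrable_secondDeriv (integrable_zero _ _ _) ?_
  simpa [laplacian, hs] using h0

/-- Vanishing slope sums exclude kinks, so the derivative is continuous on the open edge; its own
derivative vanishes a.e., hence it is constant. -/
theorem edge_affine (hf : IsPiecewiseC2 f) (h0 : secondDeriv f =ᵐ[G.lebesgue] 0)
    (hs : ∀ p, slopeSum f p = 0) (e : E) :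
    ∃ d, (∀ t ∈ Icc 0 (G.length e), f (G.pt e t) = f (G.pt e 0) + d * t) ∧
      derivWithin (fun s => f (G.pt e s)) (Ici 0) 0 = d ∧
      derivWithin (fun s => f (G.pt e s)) (Iic (G.length e)) (G.length e) = d := by
  set φ := fun s => f (G.pt e s) with hφ
  have hl := G.length_pos e
  have hcd : ∀ t ∈ Ioo 0 (G.length e), DifferentiableAt ℝ φ t ∧ ContinuousAt (deriv φ) t := by
    intro t ht
    obtain ⟨d, hd, hd'⟩ := hf.hasDerivWithinAt_Ici e ht.1.le ht.2
    obtain ⟨d₁, hd₁, hd₁'⟩ := hf.hasDerivWithinAt_Iic e ht.1 ht.2.le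
    have h2 : derivWithin φ (Ici t) t - derivWithin φ (Iic t) t = 0 := hs (.inner e t ht)
    rw [hd.derivWithin (uniqueDiffOn_Ici _ _ self_mem_Ici),
      hd₁.derivWithin (uniqueDiffOn_Iic _ _ self_mem_Iic), sub_eq_zero] at h2
    subst h2
    have h3 : HasDerivAt φ d t := by
      have := hd₁.union hd
      rwa [Iic_union_Ici, hasDerivWithinAt_univ] at this
    refine ⟨h3.differentiableAt, continuousAt_iff_continuous_left'_right'.2 ⟨?_, ?_⟩⟩
    · rw [ContinuousWithinAt, h3.deriv]; exact hd₁'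
    · rw [ContinuousWithinAt, h3.deriv]; exact hd'
  have hz : ∀ᵐ t ∂volume.restrict (Ioo 0 (G.length e)), deriv (deriv φ) t = 0 := by
    have h1 := ae_of_ae_map (continuous_pt e).measurable.aemeasurable (ae_lebesgue_iff.1 h0 e)
    filter_upwards [h1, ae_restrict_mem measurableSet_Ioo] with t h1 h2
    rw [← secondDeriv_pt f e h2]
    exact h1
  obtain ⟨T, hT, hC⟩ := hf.exists_finite_edge e
  have hconst : ∀ s ∈ Ioo 0 (G.length e), ∀ t ∈ Ioo 0 (G.length e), deriv φ t = deriv φ s := by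
    intro s hs t ht
    have hsub : uIcc s t ⊆ Ioo 0 (G.length e) := ordConnected_Ioo.uIcc_subset hs ht
    have hint : IntegrableOn (deriv (deriv φ)) (uIcc s t) :=
      (hf.integrableOn_deriv_deriv e).mono_set hsub
    -- This version of the fundamental theorem tolerates the finite set `T` where the second
    -- derivative may fail to exist.
    have h1 := integral_eq_of_hasDerivAt_off_countable (deriv φ) (deriv (deriv φ)) (a := s) (b := t)
      hT.countable (fun x hx => (hcd x (hsub hx)).2.continuousWithinAt)
      (fun x hx => (hC x (hsub (Ioo_subset_Icc_self hx.1)) hx.2).differentiableAt_deriv.hasDerivAt)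
      (hint.intervalIntegrable)
    have h2 : ∫ x in s..t, deriv (deriv φ) x = 0 := by
      refine intervalIntegral.integral_zero_ae ?_
      filter_upwards [(ae_restrict_iff' measurableSet_Ioo).1 hz] with x hx hx'
      exact hx (hsub (uIoc_subset_uIcc hx'))
    linarith
  set m := G.length e / 2
  have hm : m ∈ Ioo 0 (G.length e) := ⟨by simp only [m]; linarith, by simp only [m]; linarith⟩
  refine ⟨deriv φ m, fun t ht => ?_, ?_, ?_⟩
  · have h1 := integral_eq_of_hasDerivAt_off_countable φ (fun _ => deriv φ m) (a := 0) (b := t)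
      countable_empty (hf.comp_pt e).continuousOn (fun x hx => by
        rw [min_eq_left ht.1, max_eq_right ht.1] at hx
        have hx' : x ∈ Ioo 0 (G.length e) := ⟨hx.1.1, hx.1.2.trans_le ht.2⟩
        rw [← hconst m hm x hx']
        exact (hcd x hx').1.hasDerivAt) intervalIntegrable_const
    rw [intervalIntegral.integral_const, smul_eq_mul, sub_zero] at h1
    change φ t = φ 0 + _
    linarith
  · obtain ⟨d, hd, hd'⟩ := hf.hasDerivWithinAt_Ici e le_rfl hl
    rw [hd.derivWithin (uniqueDiffOn_Ici _ _ self_mem_Ici)]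
    refine tendsto_nhds_unique hd' (tendsto_const_nhds.congr' ?_)
    filter_upwards [Ioo_mem_nhdsGT hl] with s hs using (hconst m hm s hs).symm
  · obtain ⟨d, hd, hd'⟩ := hf.hasDerivWithinAt_Iic e hl le_rfl
    rw [hd.derivWithin (uniqueDiffOn_Iic _ _ self_mem_Iic)]
    refine tendsto_nhds_unique hd' (tendsto_const_nhds.congr' ?_)
    filter_upwards [Ioo_mem_nhdsLT hl] with s hs using (hconst m hm s hs).symm

/-- The atoms of the Laplacian are the slope sums, so these vanish and `f` is affine on edges. Its
vertex values are then discretely harmonic, and zero energy with connectedness makes them constant.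
-/
theorem eq_of_laplacian_eq_zero [Fintype V] (hf : IsPiecewiseC2 f) (h0 : laplacian f = 0)
    (p q : G.Point) : f p = f q := by
  have hs : ∀ p, slopeSum f p = 0 := fun p => by
    have := laplacian_singleton hf p
    rw [h0] at this
    simpa using this.symm
  choose d hd hd0 hd1 using edge_affine hf (ae_secondDeriv_eq_zero hf h0 hs) hs
  have hdl : ∀ e, d e = (f (.vert (G.tgt e)) - f (.vert (G.src e))) / G.length e := fun e => by
    have := hd e (G.length e) ⟨(G.length_pos e).le, le_rfl⟩
    rw [pt_zero, pt_length] at this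
    rw [eq_div_iff (G.length_pos e).ne']
    linarith
  set a : V → ℝ := fun v => f (.vert v)
  have hlap : ∀ v, G.graphLap a v = 0 := fun v => by
    have h1 := hs (.vert v)
    simp only [slopeSum, hd0, hd1, hdl] at h1
    have h2 : G.graphLap a v = -1 * G.endSum (fun e => (a (G.tgt e) - a (G.src e)) / G.length e)
        (fun e => -((a (G.tgt e) - a (G.src e)) / G.length e)) v := by
      rw [← endSum_const_mul, graphLap]
      congr 1 <;> · ext e; ring
    rw [h2, endSum]
    simp only [a, h1, mul_zero]
  have ha : ∀ u v, a u = a v := eq_of_energy_nonpos (G := G) (by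
    rw [← sum_mul_graphLap]
    simp [hlap])
  have hv : ∀ v p, f p = a v := by
    intro v p
    cases p with
    | vert u => exact ha u v
    | inner e t ht =>
      have h1 := hd e t ⟨ht.1.le, ht.2.le⟩
      rw [pt_of_mem e ht, hdl, pt_zero] at h1
      rw [h1]
      change a _ + (a _ - a _) / _ * t = _
      rw [ha (G.tgt e) v, ha (G.src e) v]
      simp
  obtain ⟨v⟩ := G.nonempty
  rw [hv v p, hv v q]

theorem sub_eq_sub_of_laplacian_eq [Fintype V] (hf : IsPiecewiseC2 f) (hh : IsPiecewiseC2 h)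
    (heq : laplacian f = laplacian h) (p q : G.Point) : f p - h p = f q - h q := by
  have h1 := (hf.add (hh.const_mul (-1))).1
  have h2 := eq_of_laplacian_eq_zero h1 (by
    rw [laplacian_add hf (hh.const_mul (-1)), laplacian_const_mul hh, heq]
    exact (congrArg _ (neg_one_smul _ _)).trans (add_neg_cancel _)) p q
  linarith

end Uniqueness

end WeightedGraph

/-! ### Explicit functions on the realization and their Laplacians. -/

namespace WeightedGraph

open Set Filter Topology

section PointFunctions

variable {V E : Type*} (G : WeightedGraph V E)

/-- The function that is affine on edges with given values at the vertices. -/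
noncomputable def lin (a : V → ℝ) : G.Point → ℝ
  | .vert v => a v
  | .inner e t _ => (1 - t / G.length e) * a (G.src e) + t / G.length e * a (G.tgt e)

/-- The function vanishing at the vertices with second derivative `-c e` on the edge `e`. -/
noncomputable def bubble (c : E → ℝ) : G.Point → ℝ
  | .vert _ => 0
  | .inner e t _ => c e / 2 * (t * (G.length e - t))

variable {G}

open scoped Classical in
/-- The Dirichlet Green's function of the open edges. -/
noncomputable def edgeGreen : G.Point → G.Point → ℝ
  | .inner e s _, .inner e' t _ => if e' = e then min s t - s * t / G.length e else 0
  | _, _ => 0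

theorem lin_pt (a : V → ℝ) (e : E) {t : ℝ} (ht : t ∈ Icc 0 (G.length e)) :
    G.lin a (G.pt e t) = (1 - t / G.length e) * a (G.src e) + t / G.length e * a (G.tgt e) := by
  have := (G.length_pos e).ne'
  rcases eq_or_lt_of_le ht.1 with h | h0
  · subst h; simp [lin]
  rcases eq_or_lt_of_le ht.2 with h | h1
  · subst h; simp [lin, this]
  · rw [pt_of_mem e ⟨h0, h1⟩]; rfl

theorem bubble_pt (c : E → ℝ) (e : E) {t : ℝ} (ht : t ∈ Icc 0 (G.length e)) :
    G.bubble c (G.pt e t) = c e / 2 * (t * (G.length e - t)) := by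
  rcases eq_or_lt_of_le ht.1 with h | h0
  · subst h; simp [bubble]
  rcases eq_or_lt_of_le ht.2 with h | h1
  · subst h; simp [bubble]
  · rw [pt_of_mem e ⟨h0, h1⟩]; rfl

open scoped Classical in
theorem edgeGreen_pt (e : E) {s : ℝ} (hs : 0 < s ∧ s < G.length e) (e' : E) {t : ℝ}
    (ht : t ∈ Icc 0 (G.length e')) : edgeGreen (.inner e s hs) (G.pt e' t) =
      if e' = e then min s t - s * t / G.length e else 0 := by
  have := (G.length_pos e).ne'
  rcases eq_or_lt_of_le ht.1 with h | h0
  · subst h; simp [edgeGreen, hs.1.le]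
  rcases eq_or_lt_of_le ht.2 with h | h1
  · subst h
    by_cases he : e' = e
    · subst he; simp [edgeGreen, this, hs.2.le]
    · simp [edgeGreen, he]
  · rw [pt_of_mem e' ⟨h0, h1⟩]; rfl

theorem edgeGreen_vert (v : V) : edgeGreen (G := G) (.vert v) = fun _ => 0 := by
  ext x; cases x <;> rfl

theorem edgeGreen_comm (x y : G.Point) : edgeGreen x y = edgeGreen y x := by
  cases x with
  | vert v => cases y <;> rfl
  | inner e s hs =>
    cases y with
    | vert v => rfl
    | inner e' t ht =>
      by_cases h : e = e'
      · subst h; simp only [edgeGreen, min_comm, mul_comm]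
      · simp only [edgeGreen, h, Ne.symm h, if_false]

theorem lin_add (a b : V → ℝ) (x : G.Point) : G.lin (fun v => a v + b v) x = G.lin a x + G.lin b x := by
  cases x <;> simp only [lin]; ring

theorem lin_const_mul (r : ℝ) (a : V → ℝ) (x : G.Point) :
    G.lin (fun v => r * a v) x = r * G.lin a x := by
  cases x <;> simp only [lin]; ring

theorem lin_const (r : ℝ) (x : G.Point) : G.lin (fun _ => r) x = r := by
  cases x <;> simp only [lin]; ring

theorem lin_sum {ι : Type*} (s : Finset ι) (a : ι → V → ℝ) (x : G.Point) :
    G.lin (fun v => ∑ i ∈ s, a i v) x = ∑ i ∈ s, G.lin (a i) x := by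
  cases x with
  | vert v => rfl
  | inner e t ht => simp only [lin, Finset.sum_add_distrib, Finset.mul_sum]

theorem lin_comm (b : V → V → ℝ) (x y : G.Point) :
    G.lin (fun u => G.lin (b u) y) x = G.lin (fun v => G.lin (fun u => b u v) x) y := by
  cases x <;> cases y <;> simp only [lin]; ring

end PointFunctions

section Laplacian

variable {V E : Type*} {G : WeightedGraph V E}

/-- The hypotheses describing a function on `Γ` by explicit formulas `P` on the edges, which are
quadratic polynomials with second derivative `c` away from a finite set `S`. -/
structure IsEdgeQuadratic (f : G.Point → ℝ) (P : E → ℝ → ℝ) (c : E → ℝ) (S : Set G.Point) :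
    Prop where
  eq_on : ∀ e, ∀ t ∈ Icc 0 (G.length e), f (G.pt e t) = P e t
  cont : ∀ e, Continuous (P e)
  finite : S.Finite
  quad : ∀ e t (ht : 0 < t ∧ t < G.length e), .inner e t ht ∉ S →
    ∃ p q, P e =ᶠ[𝓝 t] fun x => p + q * x + c e / 2 * x ^ 2

namespace IsEdgeQuadratic

variable {f : G.Point → ℝ} {P : E → ℝ → ℝ} {c : E → ℝ} {S : Set G.Point}

theorem eventuallyEq (hf : IsEdgeQuadratic f P c S) {e : E} {t : ℝ}
    (ht : 0 < t ∧ t < G.length e) : (fun s => f (G.pt e s)) =ᶠ[𝓝 t] P e := by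
  filter_upwards [Ioo_mem_nhds ht.1 ht.2] with s hs using hf.eq_on e s (Ioo_subset_Icc_self hs)

theorem continuous (hf : IsEdgeQuadratic f P c S) : Continuous f := by
  refine continuous_iff_comp_pt.2 fun e => ?_
  have hl := (G.length_pos e).le
  -- Since `pt` is constant outside the segment, the formula `P e` must be precomposed with the
  -- clamp to it.
  have : (fun t => f (G.pt e t)) = fun t => P e (max 0 (min (G.length e) t)) := by
    ext t
    rcases G.pt_mem_cases e t with ⟨h, h'⟩ | ⟨h, h'⟩ | ⟨h, h'⟩
    · rw [max_eq_left ((min_le_right _ _).trans h), ← hf.eq_on e 0 ⟨le_rfl, hl⟩, pt_zero, h']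
    · rw [min_eq_left h, max_eq_right hl, ← hf.eq_on e _ ⟨hl, le_rfl⟩, pt_length, h']
    · rw [min_eq_right h.2.le, max_eq_right h.1.le, hf.eq_on e t ⟨h.1.le, h.2.le⟩]
  rw [this]
  exact (hf.cont e).comp (by fun_prop)

theorem secondDeriv_eq (hf : IsEdgeQuadratic f P c S) (e : E) (t : ℝ)
    (ht : 0 < t ∧ t < G.length e) (hS : .inner e t ht ∉ S) :
    secondDeriv f (.inner e t ht) = c e := by
  obtain ⟨p, q, hpq⟩ := hf.quad e t ht hS
  have h1 : deriv (fun x : ℝ => p + q * x + c e / 2 * x ^ 2) = fun x => q + c e * x := by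
    ext x
    have h : HasDerivAt (fun x : ℝ => p + q * x + c e / 2 * x ^ 2)
        (q * 1 + c e / 2 * (((2 : ℕ) : ℝ) * x ^ (2 - 1))) x :=
      (((hasDerivAt_id x).const_mul q).const_add p).add ((hasDerivAt_pow 2 x).const_mul (c e / 2))
    rw [h.deriv]; norm_num; ring
  have h2 : HasDerivAt (fun x : ℝ => q + c e * x) (c e * 1) t :=
    ((hasDerivAt_id t).const_mul (c e)).const_add q
  change deriv (deriv fun s => f (G.pt e s)) t = c e
  rw [((hf.eventuallyEq ht).trans hpq).deriv.deriv_eq, h1, h2.deriv, mul_one]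

theorem derivWithin_Ici (hf : IsEdgeQuadratic f P c S) {e : E} {t d : ℝ} (h0 : 0 ≤ t)
    (h1 : t < G.length e) (hd : HasDerivWithinAt (P e) d (Ici t) t) :
    derivWithin (fun s => f (G.pt e s)) (Ici t) t = d := by
  refine (hd.congr_of_eventuallyEq ?_ (hf.eq_on e t ⟨h0, h1.le⟩)).derivWithin
    (uniqueDiffOn_Ici _ _ self_mem_Ici)
  filter_upwards [Ico_mem_nhdsGE h1] with s hs using hf.eq_on e s ⟨h0.trans hs.1, hs.2.le⟩

theorem derivWithin_Iic (hf : IsEdgeQuadratic f P c S) {e : E} {t d : ℝ} (h0 : 0 < t)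
    (h1 : t ≤ G.length e) (hd : HasDerivWithinAt (P e) d (Iic t) t) :
    derivWithin (fun s => f (G.pt e s)) (Iic t) t = d := by
  refine (hd.congr_of_eventuallyEq ?_ (hf.eq_on e t ⟨h0.le, h1⟩)).derivWithin
    (uniqueDiffOn_Iic _ _ self_mem_Iic)
  filter_upwards [Ioc_mem_nhdsLE h0] with s hs using hf.eq_on e s ⟨hs.1.le, hs.2.trans h1⟩

end IsEdgeQuadratic

theorem isEdgeQuadratic_lin (a : V → ℝ) : IsEdgeQuadratic (G.lin a)
    (fun e t => (1 - t / G.length e) * a (G.src e) + t / G.length e * a (G.tgt e)) (fun _ => 0) ∅ :=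
  ⟨fun e t ht => lin_pt a e ht, fun e => by fun_prop, finite_empty, fun e t ht _ =>
    ⟨a (G.src e), (a (G.tgt e) - a (G.src e)) / G.length e, .of_forall fun x => by ring⟩⟩

theorem isEdgeQuadratic_bubble (c : E → ℝ) : IsEdgeQuadratic (G.bubble c)
    (fun e t => c e / 2 * (t * (G.length e - t))) (fun e => -c e) ∅ :=
  ⟨fun e t ht => bubble_pt c e ht, fun e => by fun_prop, finite_empty, fun e t ht _ =>
    ⟨0, c e / 2 * G.length e, .of_forall fun x => by ring⟩⟩

open scoped Classical in
theorem isEdgeQuadratic_edgeGreen (e₀ : E) (s : ℝ) (hs : 0 < s ∧ s < G.length e₀) :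
    IsEdgeQuadratic (edgeGreen (.inner e₀ s hs))
      (fun e t => if e = e₀ then min s t - s * t / G.length e₀ else 0) (fun _ => 0)
      {.inner e₀ s hs} := by
  refine ⟨fun e t ht => edgeGreen_pt e₀ hs e ht, fun e => ?_, finite_singleton _,
    fun e t ht hne => ?_⟩
  · split_ifs <;> fun_prop
  · by_cases he : e = e₀
    · subst he
      simp only [if_true]
      have hne' : t ≠ s := fun h => hne (by subst h; rfl)
      rcases lt_or_gt_of_ne hne' with h | h
      · refine ⟨0, 1 - s / G.length e, ?_⟩
        filter_upwards [Iio_mem_nhds h] with x hx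
        rw [min_eq_right (le_of_lt hx)]; ring
      · refine ⟨s, -s / G.length e, ?_⟩
        filter_upwards [Ioi_mem_nhds h] with x hx
        rw [min_eq_left (le_of_lt hx)]; ring
    · exact ⟨0, 0, .of_forall fun x => by simp [he]⟩

open scoped Classical in
/-- The hat functions form a partition of unity, which gives barycentric coordinates. -/
noncomputable def hat (v : V) : G.Point → ℝ := G.lin (Pi.single v 1)

/-- The discrete signed measure `∑ v, w v · δ_v`. -/
noncomputable def vertexMass [Fintype V] (G : WeightedGraph V E) (w : V → ℝ) :
    SignedMeasure G.Point :=
  ∑ v, VectorMeasure.dirac (.vert v) (w v)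

section Vertex

variable [Fintype V]

theorem lin_eq_sum_hat (a : V → ℝ) (x : G.Point) : G.lin a x = ∑ v, a v * hat v x := by
  classical
  have : a = fun u => ∑ v, a v * (Pi.single v 1 : V → ℝ) u := by
    ext u; simp [Pi.single_apply]
  conv_lhs => rw [this]
  rw [lin_sum]
  simp only [lin_const_mul, hat]

theorem vertexMass_neg (w : V → ℝ) : G.vertexMass (fun v => -w v) = -G.vertexMass w := by
  ext A hA
  simp only [vertexMass, _root_.sum_apply, _root_.neg_apply, ← Finset.sum_neg_distrib]
  refine Finset.sum_congr rfl fun v _ => ?_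
  by_cases h : Point.vert v ∈ A <;> simp [h, hA]

theorem vertexMass_add (w w' : V → ℝ) :
    G.vertexMass (fun v => w v + w' v) = G.vertexMass w + G.vertexMass w' := by
  simp only [vertexMass, dirac_add, Finset.sum_add_distrib]

end Vertex

variable [Fintype E]

namespace IsEdgeQuadratic

variable {f : G.Point → ℝ} {P : E → ℝ → ℝ} {c : E → ℝ} {S : Set G.Point}

theorem isPiecewiseC2 (hf : IsEdgeQuadratic f P c S) : IsPiecewiseC2 f := by
  refine ⟨hf.continuous, ⟨S, hf.finite, fun e t h0 h1 hS => ?_⟩,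
    memLp_of_edge_constant hf.finite hf.secondDeriv_eq⟩
  rw [pt_of_mem e ⟨h0, h1⟩] at hS
  obtain ⟨p, q, hpq⟩ := hf.quad e t ⟨h0, h1⟩ hS
  have : ContDiff ℝ 2 fun x : ℝ => p + q * x + c e / 2 * x ^ 2 := by fun_prop
  exact this.contDiffAt.congr_of_eventuallyEq ((hf.eventuallyEq ⟨h0, h1⟩).trans hpq)

theorem slopeSum_inner (hf : IsEdgeQuadratic f P c S) (e : E) (t : ℝ)
    (ht : 0 < t ∧ t < G.length e) (hS : .inner e t ht ∉ S) : slopeSum f (.inner e t ht) = 0 := by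
  obtain ⟨p, q, hpq⟩ := hf.quad e t ht hS
  have hd : DifferentiableAt ℝ (P e) t :=
    (by fun_prop : DifferentiableAt ℝ (fun x : ℝ => p + q * x + c e / 2 * x ^ 2) t)
      |>.congr_of_eventuallyEq hpq
  have h1 := hf.derivWithin_Ici ht.1.le ht.2 hd.hasDerivAt.hasDerivWithinAt
  have h2 := hf.derivWithin_Iic ht.1 ht.2.le hd.hasDerivAt.hasDerivWithinAt
  change derivWithin _ _ _ - derivWithin _ _ _ = 0
  rw [h1, h2, sub_self]

theorem slopeSum_vert (hf : IsEdgeQuadratic f P c S) {α β : E → ℝ}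
    (hα : ∀ e, HasDerivWithinAt (P e) (α e) (Ici 0) 0)
    (hβ : ∀ e, HasDerivWithinAt (P e) (-β e) (Iic (G.length e)) (G.length e)) (v : V) :
    slopeSum f (.vert v) = G.endSum α β v := by
  have h1 := fun e => hf.derivWithin_Ici le_rfl (G.length_pos e) (hα e)
  have h2 := fun e => hf.derivWithin_Iic (G.length_pos e) le_rfl (hβ e)
  simp only [slopeSum, endSum, h1, h2, neg_neg]

end IsEdgeQuadratic

theorem isPiecewiseC2_lin (a : V → ℝ) : IsPiecewiseC2 (G.lin a) :=
  (isEdgeQuadratic_lin a).isPiecewiseC2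

theorem isPiecewiseC2_bubble (c : E → ℝ) : IsPiecewiseC2 (G.bubble c) :=
  (isEdgeQuadratic_bubble c).isPiecewiseC2

theorem isPiecewiseC2_edgeGreen (y : G.Point) : IsPiecewiseC2 (edgeGreen y) := by
  cases y with
  | vert v =>
    rw [edgeGreen_vert]
    exact (funext (lin_const (G := G) 0)) ▸ isPiecewiseC2_lin (G := G) fun _ => 0
  | inner e s hs => exact (isEdgeQuadratic_edgeGreen e s hs).isPiecewiseC2

variable [Fintype V]

/-- `α` and `β` are the outward slopes at the two ends, whence the sign of `β` in the derivative
taken towards the target. -/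
theorem IsEdgeQuadratic.laplacian_eq {f : G.Point → ℝ} {P : E → ℝ → ℝ} {c : E → ℝ}
    (hf : IsEdgeQuadratic f P c ∅) {α β : E → ℝ}
    (hα : ∀ e, HasDerivWithinAt (P e) (α e) (Ici 0) 0)
    (hβ : ∀ e, HasDerivWithinAt (P e) (-β e) (Iic (G.length e)) (G.length e)) :
    laplacian f = -G.edgeDensity c - G.vertexMass (G.endSum α β) := by
  classical
  rw [laplacian, withDensityᵥ_of_edge_constant hf.finite hf.secondDeriv_eq,
    finsum_eq_sum_of_support_subset (s := Finset.univ.image Point.vert), vertexMass,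
    Finset.sum_image]
  · simp only [hf.slopeSum_vert hα hβ]
  · exact fun u _ v _ h => by injection h
  · intro p hp
    cases p with
    | vert v => simp
    | inner e t ht => exact absurd (by simp [hf.slopeSum_inner e t ht (by simp)]) hp

theorem IsEdgeQuadratic.laplacian_eq_of_singleton {f : G.Point → ℝ} {P : E → ℝ → ℝ} {c : E → ℝ}
    {e₀ : E} {s : ℝ} {hs : 0 < s ∧ s < G.length e₀} (hf : IsEdgeQuadratic f P c {.inner e₀ s hs})
    {α β : E → ℝ}
    (hα : ∀ e, HasDerivWithinAt (P e) (α e) (Ici 0) 0)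
    (hβ : ∀ e, HasDerivWithinAt (P e) (-β e) (Iic (G.length e)) (G.length e)) {d d' : ℝ}
    (hd : HasDerivWithinAt (P e₀) d (Ici s) s) (hd' : HasDerivWithinAt (P e₀) d' (Iic s) s) :
    laplacian f = -G.edgeDensity c - G.vertexMass (G.endSum α β) -
      VectorMeasure.dirac (.inner e₀ s hs) (d - d') := by
  classical
  have h0 : slopeSum f (.inner e₀ s hs) = d - d' :=
    congrArg₂ (· - ·) (hf.derivWithin_Ici hs.1.le hs.2 hd) (hf.derivWithin_Iic hs.1 hs.2.le hd')
  rw [laplacian, withDensityᵥ_of_edge_constant hf.finite hf.secondDeriv_eq,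
    finsum_eq_sum_of_support_subset (s := insert (.inner e₀ s hs) (Finset.univ.image Point.vert)),
    vertexMass, Finset.sum_insert (by simp), Finset.sum_image, h0]
  · simp only [hf.slopeSum_vert hα hβ]
    abel
  · exact fun u _ v _ h => by injection h
  · intro p hp
    cases p with
    | vert v => simp
    | inner e t ht =>
      by_cases h : Point.inner e t ht = .inner e₀ s hs
      · simp [h]
      · exact absurd (by simp [hf.slopeSum_inner e t ht (by simpa using h)]) hp

theorem laplacian_lin (a : V → ℝ) : laplacian (G.lin a) = G.vertexMass (G.graphLap a) := by
  have hd : ∀ e t, HasDerivAt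
      (fun t => (1 - t / G.length e) * a (G.src e) + t / G.length e * a (G.tgt e))
      ((a (G.tgt e) - a (G.src e)) / G.length e) t := fun e t => by
    have h := (((hasDerivAt_id t).div_const (G.length e)).const_sub 1).mul_const (a (G.src e))
      |>.add (((hasDerivAt_id t).div_const (G.length e)).mul_const (a (G.tgt e)))
    exact h.congr_deriv (by ring)
  rw [(isEdgeQuadratic_lin a).laplacian_eq (α := fun e => (a (G.tgt e) - a (G.src e)) / G.length e)
    (β := fun e => (a (G.src e) - a (G.tgt e)) / G.length e)
    (fun e => (hd e _).hasDerivWithinAt)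
    (fun e => ((hd e _).hasDerivWithinAt).congr_deriv (by ring)),
    show G.edgeDensity (fun _ => 0) = 0 by simp [edgeDensity], neg_zero, zero_sub,
    ← vertexMass_neg]
  congr 1
  ext v
  rw [← neg_one_mul, ← endSum_const_mul, graphLap]
  congr 1 <;> · ext e; ring

theorem laplacian_bubble (c : E → ℝ) : laplacian (G.bubble c) =
    G.edgeDensity c - G.vertexMass (G.endSum (fun e => c e * G.length e / 2)
      (fun e => c e * G.length e / 2)) := by
  have hd : ∀ e t, HasDerivAt (fun t => c e / 2 * (t * (G.length e - t)))
      (c e / 2 * (G.length e - 2 * t)) t := fun e t => by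
    have h := (((hasDerivAt_id t).mul ((hasDerivAt_id t).const_sub (G.length e))).const_mul (c e / 2))
    exact h.congr_deriv (by simp only [id]; ring)
  rw [(isEdgeQuadratic_bubble c).laplacian_eq (α := fun e => c e * G.length e / 2)
    (β := fun e => c e * G.length e / 2)
    (fun e => ((hd e _).hasDerivWithinAt).congr_deriv (by ring))
    (fun e => ((hd e _).hasDerivWithinAt).congr_deriv (by ring))]
  have : G.edgeDensity (fun e => -c e) = -G.edgeDensity c := by
    simp only [edgeDensity, ← Finset.sum_neg_distrib]
    exact Finset.sum_congr rfl fun e _ => by module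
  rw [this, neg_neg]

/-- The slope drops by 1 at `y`, producing the Dirac mass. The outward slopes at the ends, `1 - s /
l` and `s / l`, are the barycentric coordinates of `y`. At a vertex both sides vanish. -/
theorem laplacian_edgeGreen (y : G.Point) : laplacian (edgeGreen y) =
    VectorMeasure.dirac y 1 - G.vertexMass (fun v => hat v y) := by
  classical
  cases y with
  | vert v =>
    have h0 : laplacian (edgeGreen (G := G) (.vert v)) = 0 := by
      have := laplacian_const_mul (isPiecewiseC2_edgeGreen (G := G) (.vert v)) 0
      simpa [edgeGreen_vert] using this
    rw [h0, vertexMass, Finset.sum_eq_single v]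
    · simp [hat, lin]
    · intro u _ hu
      simp [hat, lin, hu.symm]
    · simp
  | inner e₀ s hs =>
    set l := G.length e₀
    have hl : 0 < l := G.length_pos e₀
    have hd1 : ∀ t, HasDerivAt (fun x : ℝ => x - s * x / l) (1 - s / l) t := fun t => by
      have h := (hasDerivAt_id t).sub (((hasDerivAt_id t).const_mul s).div_const l)
      exact h.congr_deriv (by ring)
    have hd2 : ∀ t, HasDerivAt (fun x : ℝ => s - s * x / l) (-(s / l)) t := fun t => by
      have h := (((hasDerivAt_id t).const_mul s).div_const l).const_sub s
      exact h.congr_deriv (by ring)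
    have hmin1 : ∀ t ≤ s, min s t - s * t / l = t - s * t / l := fun t ht => by rw [min_eq_right ht]
    have hmin2 : ∀ t, s ≤ t → min s t - s * t / l = s - s * t / l := fun t ht => by rw [min_eq_left ht]
    have h1 : HasDerivWithinAt (fun t => min s t - s * t / l) (-(s / l)) (Ici s) s :=
      (hd2 s).hasDerivWithinAt.congr (fun t ht => hmin2 t ht) (hmin2 s le_rfl)
    have h2 : HasDerivWithinAt (fun t => min s t - s * t / l) (1 - s / l) (Iic s) s :=
      (hd1 s).hasDerivWithinAt.congr (fun t ht => hmin1 t ht) (hmin1 s le_rfl)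
    have h3 : HasDerivAt (fun t => min s t - s * t / l) (1 - s / l) 0 :=
      (hd1 0).congr_of_eventuallyEq (by
        filter_upwards [Iio_mem_nhds hs.1] with t ht using hmin1 t (le_of_lt ht))
    have h4 : HasDerivAt (fun t => min s t - s * t / l) (-(s / l)) l :=
      (hd2 l).congr_of_eventuallyEq (by
        filter_upwards [Ioi_mem_nhds hs.2] with t ht using hmin2 t (le_of_lt ht))
    rw [(isEdgeQuadratic_edgeGreen e₀ s hs).laplacian_eq_of_singleton
      (α := fun e => if e = e₀ then 1 - s / l else 0) (β := fun e => if e = e₀ then s / l else 0)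
      (d := -(s / l)) (d' := 1 - s / l)]
    · have : G.edgeDensity (fun _ => 0) = 0 := by simp [edgeDensity]
      rw [this, show -(s / l) - (1 - s / l) = (-1) * 1 by ring, dirac_smul]
      have hw : G.endSum (fun e => if e = e₀ then 1 - s / l else 0)
          (fun e => if e = e₀ then s / l else 0) = fun v => hat v (.inner e₀ s hs) := by
        ext v
        simp only [endSum, hat, lin, Pi.single_apply, Finset.sum_filter]
        rw [Finset.sum_eq_single e₀ (by intro e _ he; simp [he]) (by simp),
          Finset.sum_eq_single e₀ (by intro e _ he; simp [he]) (by simp)]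
        simp [l]
      rw [hw]
      module
    · intro e
      by_cases he : e = e₀
      · subst he; simpa using h3.hasDerivWithinAt
      · simpa [he] using hasDerivWithinAt_const (0 : ℝ) (Ici 0) (0 : ℝ)
    · intro e
      by_cases he : e = e₀
      · subst he; simpa using h4.hasDerivWithinAt
      · simpa [he] using hasDerivWithinAt_const (G.length e) (Iic (G.length e)) (0 : ℝ)
    · simpa using h1
    · simpa using h2

end Laplacian

end WeightedGraph

/-! ### Edge integrals, the discrete Green's function and Foster's formula. -/

namespace WeightedGraph

open Set Filter Topology

section EdgeIntegrals

variable {V E : Type*} {G : WeightedGraph V E}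

theorem card_vertex_pos [Fintype V] (G : WeightedGraph V E) : (0 : ℝ) < Fintype.card V :=
  Nat.cast_pos.2 (Fintype.card_pos_iff.2 G.nonempty)

theorem sum_hat [Fintype V] (x : G.Point) : ∑ v, hat v x = 1 := by
  simpa [lin_const] using (lin_eq_sum_hat (G := G) (fun _ => 1) x).symm

theorem integral_lin_pt (a : V → ℝ) (e : E) : ∫ t in (0 : ℝ)..G.length e, G.lin a (G.pt e t) =
    G.length e * ((a (G.src e) + a (G.tgt e)) / 2) := by
  have hl := (G.length_pos e)
  have h1 : ∫ t in (0 : ℝ)..G.length e, G.lin a (G.pt e t) = ∫ t in (0 : ℝ)..G.length e,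
      (a (G.src e) + (a (G.tgt e) - a (G.src e)) / G.length e * t) := by
    refine intervalIntegral.integral_congr fun t ht => ?_
    rw [uIcc_of_le hl.le] at ht
    simp only [lin_pt a e ht]; ring
  rw [h1, intervalIntegral.integral_add (by simp) (Continuous.intervalIntegrable (by fun_prop) _ _),
    intervalIntegral.integral_const_mul, integral_id, intervalIntegral.integral_const, smul_eq_mul]
  field_simp
  ring

theorem integral_bubble_pt (c : E → ℝ) (e : E) :
    ∫ t in (0 : ℝ)..G.length e, G.bubble c (G.pt e t) = c e * G.length e ^ 3 / 12 := by
  have hl := (G.length_pos e)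
  have h1 : ∫ t in (0 : ℝ)..G.length e, G.bubble c (G.pt e t) = ∫ t in (0 : ℝ)..G.length e,
      (c e / 2 * G.length e * t - c e / 2 * t ^ 2) := by
    refine intervalIntegral.integral_congr fun t ht => ?_
    rw [uIcc_of_le hl.le] at ht
    simp only [bubble_pt c e ht]; ring
  rw [h1, intervalIntegral.integral_sub (Continuous.intervalIntegrable (by fun_prop) _ _)
    (Continuous.intervalIntegrable (by fun_prop) _ _), intervalIntegral.integral_const_mul,
    intervalIntegral.integral_const_mul, integral_id, integral_pow]
  norm_num
  ring

theorem integral_min_sub {s l : ℝ} (h0 : 0 ≤ s) (hl : 0 < l) (h1 : s ≤ l) :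
    ∫ t in (0 : ℝ)..l, (min s t - s * t / l) = s * (l - s) / 2 := by
  have hc : Continuous fun t => min s t := by fun_prop
  have h2 : ∫ t in (0 : ℝ)..l, min s t = s ^ 2 / 2 + s * (l - s) := by
    rw [← intervalIntegral.integral_add_adjacent_intervals (hc.intervalIntegrable 0 s)
      (hc.intervalIntegrable s l)]
    congr 1
    · rw [intervalIntegral.integral_congr (g := fun t => t), integral_id]
      · ring
      · intro t ht
        rw [uIcc_of_le h0] at ht
        exact min_eq_right ht.2
    · rw [intervalIntegral.integral_congr (g := fun _ => s), intervalIntegral.integral_const,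
        smul_eq_mul, mul_comm]
      intro t ht
      rw [uIcc_of_le h1] at ht
      exact min_eq_left ht.1
  rw [intervalIntegral.integral_sub (hc.intervalIntegrable _ _)
    (Continuous.intervalIntegrable (by fun_prop) _ _), h2, intervalIntegral.integral_div,
    intervalIntegral.integral_const_mul, integral_id]
  field_simp
  ring

/-- Integrating the Dirichlet Green's function against a constant solves $-u''=c$ with zero boundary
values. -/
theorem sum_integral_edgeGreen [Fintype E] (c : E → ℝ) (y : G.Point) :
    ∑ e, c e * ∫ t in (0 : ℝ)..G.length e, edgeGreen y (G.pt e t) = G.bubble c y := by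
  classical
  cases y with
  | vert v => simp [edgeGreen_vert, bubble]
  | inner e₀ s hs =>
    have hl := G.length_pos e₀
    have h1 : ∀ e, ∫ t in (0 : ℝ)..G.length e, edgeGreen (.inner e₀ s hs) (G.pt e t) =
        ∫ t in (0 : ℝ)..G.length e, if e = e₀ then min s t - s * t / G.length e₀ else 0 := by
      intro e
      refine intervalIntegral.integral_congr fun t ht => ?_
      rw [uIcc_of_le (G.length_pos e).le] at ht
      simp only [edgeGreen_pt e₀ hs e ht]
    rw [Finset.sum_eq_single e₀]
    · rw [h1]
      simp only [if_true]
      rw [integral_min_sub hs.1.le hl hs.2.le]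
      simp only [bubble]; ring
    · intro e _ he
      rw [h1]
      simp [he]
    · simp

end EdgeIntegrals

section DiscreteGreen

variable {V E : Type*} [Fintype E] {G : WeightedGraph V E}

theorem endSum_congr {α β α' β' : E → ℝ} {u : V} (hα : ∀ e, G.src e = u → α e = α' e)
    (hβ : ∀ e, G.tgt e = u → β e = β' e) : G.endSum α β u = G.endSum α' β' u := by
  classical
  unfold endSum
  congr 1
  · exact Finset.sum_congr rfl fun e he => hα e (Finset.mem_filter.1 he).2
  · exact Finset.sum_congr rfl fun e he => hβ e (Finset.mem_filter.1 he).2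

theorem graphLap_add (a b : V → ℝ) (u : V) :
    G.graphLap (fun v => a v + b v) u = G.graphLap a u + G.graphLap b u := by
  rw [graphLap, graphLap, graphLap, ← endSum_add]
  congr 1 <;> · ext e; ring

theorem graphLap_const_mul (c : ℝ) (a : V → ℝ) (u : V) :
    G.graphLap (fun v => c * a v) u = c * G.graphLap a u := by
  rw [graphLap, graphLap, ← endSum_const_mul]
  congr 1 <;> · ext e; ring

theorem graphLap_sum {ι : Type*} (s : Finset ι) (a : ι → V → ℝ) (u : V) :
    G.graphLap (fun v => ∑ i ∈ s, a i v) u = ∑ i ∈ s, G.graphLap (a i) u := by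
  classical
  induction s using Finset.induction_on with
  | empty =>
    have := graphLap_const_mul (G := G) 0 (fun _ => 0) u
    simpa using this
  | insert i s hi ih => simp only [Finset.sum_insert hi, graphLap_add, ih]

variable [Fintype V]

theorem sum_graphLap (a : V → ℝ) : ∑ u, G.graphLap a u = 0 := by
  have := sum_mul_graphLap (G := G) a (fun _ => 1)
  simpa using this

theorem eq_of_graphLap_eq {a b : V → ℝ} (h : ∀ u, G.graphLap a u = G.graphLap b u) (u v : V) :
    a u - b u = a v - b v := by
  have h0 : ∀ u, G.graphLap (fun v => a v + -1 * b v) u = 0 := fun u => by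
    rw [graphLap_add, graphLap_const_mul, h]; ring
  have h1 := sum_mul_graphLap (G := G) (fun v => a v + -1 * b v) (fun v => a v + -1 * b v)
  simp only [h0, mul_zero, Finset.sum_const_zero] at h1
  have := eq_of_energy_nonpos (G := G) (a := fun v => a v + -1 * b v) h1.ge u v
  linarith

-- The Laplacian has the constants as kernel; adding the all-ones matrix removes it, so the sum is
-- injective and therefore surjective.
open scoped Classical in
theorem exists_graphLap_add_sum_eq (G : WeightedGraph V E) (v : V) :
    ∃ a : V → ℝ, ∀ u, G.graphLap a u + ∑ w, a w = if u = v then 1 else 0 := by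
  let T : (V → ℝ) →ₗ[ℝ] (V → ℝ) :=
    { toFun := fun a u => G.graphLap a u + ∑ w, a w
      map_add' := fun a b => by
        ext u
        have := graphLap_add (G := G) a b u
        simp only [Pi.add_def, Finset.sum_add_distrib, this]; ring
      map_smul' := fun c a => by
        ext u
        have := graphLap_const_mul (G := G) c a u
        simp only [Pi.smul_def, smul_eq_mul, ← Finset.mul_sum, this, RingHom.id_apply]; ring }
  have hinj : Function.Injective T := by
    refine (injective_iff_map_eq_zero T).2 fun a ha => ?_
    have h1 : ∀ u, G.graphLap a u + ∑ w, a w = 0 := fun u => congrFun ha u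
    -- Summing over vertices kills the Laplacian part and leaves the number of vertices times the
    -- total of `a`.
    have h2 : ∑ w, a w = 0 := by
      have := Finset.sum_congr rfl fun u (_ : u ∈ Finset.univ) => h1 u
      rw [Finset.sum_add_distrib, sum_graphLap] at this
      simpa [(card_vertex_pos G).ne', Fintype.card_ne_zero] using this
    have h3 : ∀ u, G.graphLap a u = 0 := fun u => by simpa [h2] using h1 u
    have h4 : ∀ u v, a u = a v := eq_of_energy_nonpos (G := G) (by
      rw [← sum_mul_graphLap]; simp [h3])
    ext u
    have h5 : ∑ w, a w = Fintype.card V * a u := by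
      rw [Finset.sum_congr rfl fun w _ => h4 w u]; simp
    rw [h5] at h2
    exact (mul_eq_zero.1 h2).resolve_left (card_vertex_pos G).ne'
  obtain ⟨a, ha⟩ := LinearMap.injective_iff_surjective.1 hinj fun u => if u = v then 1 else 0
  exact ⟨a, fun u => congrFun ha u⟩

/-- A discrete Green's function, the inverse of the sum of the Laplacian and the all-ones matrix. -/
noncomputable def discreteGreen (G : WeightedGraph V E) (u v : V) : ℝ :=
  (G.exists_graphLap_add_sum_eq v).choose u

open scoped Classical in
theorem discreteGreen_spec (v u : V) : G.graphLap (fun w => G.discreteGreen w v) u +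
    ∑ w, G.discreteGreen w v = if u = v then 1 else 0 :=
  (G.exists_graphLap_add_sum_eq v).choose_spec u

open scoped Classical in
theorem graphLap_discreteGreen (v u : V) : G.graphLap (fun w => G.discreteGreen w v) u =
    (if u = v then 1 else 0) - 1 / Fintype.card V := by
  have hn := card_vertex_pos G
  have h1 := Finset.sum_congr rfl fun u (_ : u ∈ Finset.univ) => discreteGreen_spec (G := G) v u
  rw [Finset.sum_add_distrib, sum_graphLap] at h1
  have h2 : ∑ w, G.discreteGreen w v = 1 / Fintype.card V := by
    rw [eq_div_iff hn.ne']
    simpa [mul_comm] using h1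
  rw [← discreteGreen_spec (G := G), h2]; ring

/-- An inverse of a symmetric operator is symmetric: both values equal the same bilinear form, the
energy plus the product of the column sums. -/
theorem discreteGreen_comm (u v : V) : G.discreteGreen u v = G.discreteGreen v u := by
  classical
  have key : ∀ v w, G.discreteGreen v w = (∑ e, (G.discreteGreen (G.src e) w -
      G.discreteGreen (G.tgt e) w) * (G.discreteGreen (G.src e) v - G.discreteGreen (G.tgt e) v) /
        G.length e) + (∑ u, G.discreteGreen u w) * ∑ u, G.discreteGreen u v := by
    intro v w
    have h := sum_mul_graphLap (G := G) (fun u => G.discreteGreen u v)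
      (fun u => G.discreteGreen u w)
    rw [← h, Finset.sum_mul, ← Finset.sum_add_distrib]
    simp only [← mul_add, discreteGreen_spec]
    simp
  rw [key u v, key v u, mul_comm (∑ x, G.discreteGreen x v)]
  refine congrArg (· + _) ?_
  exact Finset.sum_congr rfl fun e _ => by ring

/-- The Foster coefficient `1 - r(e) / length e` of the edge `e`. -/
noncomputable def foster (G : WeightedGraph V E) (e : E) : ℝ :=
  1 - (G.discreteGreen (G.src e) (G.src e) + G.discreteGreen (G.tgt e) (G.tgt e) -
    2 * G.discreteGreen (G.src e) (G.tgt e)) / G.length e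

/-- At an edge from $u$ to $w$, with $G$ the discrete Green's function,
$G(u,u)-G(w,w)=2(G(u,u)-G(w,u))-r(u,w)$. Division by the length turns the last term into $F_e-1$,
whose sum over edge ends gives the valence and the Foster terms. -/
theorem graphLap_diag_discreteGreen (u : V) : G.graphLap (fun v => G.discreteGreen v v) u =
    2 - 2 / Fintype.card V - G.vertexValence u + G.endSum G.foster G.foster u := by
  classical
  have h1 := graphLap_discreteGreen (G := G) u u
  rw [if_pos rfl] at h1
  have h2 : G.graphLap (fun v => G.discreteGreen v v) u = 2 * G.graphLap
      (fun w => G.discreteGreen w u) u + (-1 * G.endSum (fun _ => 1) (fun _ => 1) u +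
        G.endSum G.foster G.foster u) := by
    rw [graphLap, graphLap, ← endSum_const_mul, ← endSum_const_mul, ← endSum_add, ← endSum_add]
    refine endSum_congr (fun e he => ?_) (fun e he => ?_) <;> subst he <;>
      rw [foster]
    · rw [discreteGreen_comm (G.tgt e) (G.src e)]; ring
    · ring
  rw [h2, h1, endSum_one]; ring

theorem sum_vertexValence : ∑ u, (G.vertexValence u : ℝ) = 2 * Fintype.card E := by
  have := sum_mul_endSum (G := G) (fun _ => 1) (fun _ => 1) (fun _ => 1)
  simp only [endSum_one, one_mul] at this
  rw [this]; simp; ring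

/-- Foster's formula. -/
theorem sum_foster : ∑ e, G.foster e = Fintype.card E - Fintype.card V + 1 := by
  have hn := card_vertex_pos G
  -- The diagonal identity is summed over all vertices: the Laplacian sums to 0 and each Foster
  -- coefficient is counted twice.
  have h1 := sum_graphLap (G := G) fun v => G.discreteGreen v v
  have h2 := sum_mul_endSum (G := G) (fun _ => 1) G.foster G.foster
  simp only [one_mul, Finset.sum_add_distrib] at h2
  simp only [graphLap_diag_discreteGreen, Finset.sum_add_distrib, Finset.sum_sub_distrib,
    sum_vertexValence, h2, Finset.sum_const, Finset.card_univ, nsmul_eq_mul] at h1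
  field_simp at h1
  linarith

end DiscreteGreen

/-! ### The explicit Green kernel on the realization. -/

section GreenKernel

variable {V E : Type*} [Fintype E] [Fintype V] {G : WeightedGraph V E}

/-- The Green's function of the uniform probability measure on the vertices. -/
noncomputable def greenKernel (x y : G.Point) : ℝ :=
  G.lin (fun u => G.lin (G.discreteGreen u) y) x + edgeGreen y x

theorem greenKernel_comm (x y : G.Point) : greenKernel x y = greenKernel y x := by
  rw [greenKernel, greenKernel, edgeGreen_comm, lin_comm]
  congr! 4 with v
  ext u
  exact discreteGreen_comm _ _

theorem isPiecewiseC2_greenKernel (y : G.Point) : IsPiecewiseC2 fun x => greenKernel x y :=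
  ((isPiecewiseC2_lin _).add (isPiecewiseC2_edgeGreen y)).1

theorem graphLap_lin_discreteGreen (y : G.Point) (u : V) :
    G.graphLap (fun u => G.lin (G.discreteGreen u) y) u = hat u y - 1 / Fintype.card V := by
  classical
  simp only [lin_eq_sum_hat]
  rw [graphLap_sum]
  simp only [mul_comm _ (hat _ y), graphLap_const_mul, graphLap_discreteGreen, mul_sub,
    Finset.sum_sub_distrib, ← Finset.sum_mul, sum_hat]
  simp

/-- The interpolated part has vertex masses equal to the barycentric coordinates of `y` minus the
uniform mass; the coordinates cancel those left by `edgeGreen`. -/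
theorem laplacian_greenKernel (y : G.Point) : laplacian (fun x => greenKernel x y) =
    VectorMeasure.dirac y 1 - G.vertexMass (fun _ => 1 / Fintype.card V) := by
  simp only [greenKernel]
  rw [laplacian_add (isPiecewiseC2_lin _) (isPiecewiseC2_edgeGreen y), laplacian_lin,
    laplacian_edgeGreen, show G.graphLap (fun u => G.lin (G.discreteGreen u) y) =
      fun u => hat u y + -(1 / Fintype.card V) from funext fun u => by
        rw [graphLap_lin_discreteGreen]; ring,
    vertexMass_add, vertexMass_neg]
  abel

/-- On the diagonal the bilinear interpolation falls below the linear one by $r\,t(\ell-t)/\ell^2$,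
while `edgeGreen` adds $t(\ell-t)/\ell$; together they leave $F_e\,t(\ell-t)/\ell$. -/
theorem greenKernel_diag (x : G.Point) : greenKernel x x =
    G.lin (fun v => G.discreteGreen v v) x + G.bubble (fun e => 2 * (G.foster e / G.length e)) x := by
  cases x with
  | vert v => simp [greenKernel, lin, bubble, edgeGreen]
  | inner e t ht =>
    have := (G.length_pos e).ne'
    simp only [greenKernel, lin, bubble, edgeGreen, if_true, min_self, foster,
      discreteGreen_comm (G.tgt e) (G.src e)]
    field_simp
    ring

theorem greenKernel_vert (x : G.Point) (v : V) :
    greenKernel x (.vert v) = G.lin (fun u => G.discreteGreen u v) x := by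
  simp [greenKernel, edgeGreen_vert, lin]

end GreenKernel

end WeightedGraph

/-! ### Joint continuity of the kernel and the formula for effective resistance. -/

namespace WeightedGraph

open Set Filter Topology

section JointContinuity

variable {V E : Type*} {G : WeightedGraph V E}

theorem pt_clamp (e : E) (t : ℝ) : G.pt e (max 0 (min (G.length e) t)) = G.pt e t := by
  have hl := (G.length_pos e).le
  rcases G.pt_mem_cases e t with ⟨h, h'⟩ | ⟨h, h'⟩ | ⟨h, h'⟩
  · rw [max_eq_left ((min_le_right _ _).trans h), pt_zero, h']
  · rw [min_eq_left h, max_eq_right hl, pt_length, h']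
  · rw [min_eq_right h.2.le, max_eq_right h.1.le]

/-- The edgewise criterion concerns maps out of one copy of the realization. A Lipschitz bound
uniform in `y` makes `x ↦ F x` continuous for uniform convergence, which combines with continuity in
the second variable. -/
theorem continuous_uncurry_of_lipschitz {F : G.Point → G.Point → ℝ}
    (hF : ∀ y e t t', |F (G.pt e t) y - F (G.pt e t') y| ≤ |t - t'|)
    (hc : ∀ x, Continuous (F x)) : Continuous fun p : G.Point × G.Point => F p.1 p.2 := by
  have h1 : Continuous fun x => UniformFun.ofFun (F x) := by
    refine continuous_iff_comp_pt.2 fun e => continuous_iff_continuousAt.2 fun t => ?_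
    refine UniformFun.tendsto_iff_tendstoUniformly.2 (Metric.tendstoUniformly_iff.2 fun ε hε => ?_)
    filter_upwards [Metric.ball_mem_nhds t hε] with s hs y
    refine lt_of_le_of_lt ?_ hs
    rw [dist_comm]
    exact hF y e s t
  refine continuous_iff_continuousAt.2 fun p => ?_
  have h2 : TendstoUniformly F (F p.1) (𝓝 p.1) :=
    UniformFun.tendsto_iff_tendstoUniformly.1 h1.continuousAt
  have h3 : TendstoUniformly (fun q : G.Point × G.Point => F q.1) (F p.1) (𝓝 p) := by
    intro u hu
    exact (continuousAt_fst (p := p)).eventually (h2 u hu)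
  exact h3.tendsto_comp (hc p.1).continuousAt continuousAt_snd

theorem edgeGreen_lipschitz (y : G.Point) (e : E) (t t' : ℝ) :
    |edgeGreen (G.pt e t) y - edgeGreen (G.pt e t') y| ≤ |t - t'| := by
  rw [edgeGreen_comm _ y, edgeGreen_comm _ y]
  have key : ∀ t ∈ Icc 0 (G.length e), ∀ t' ∈ Icc 0 (G.length e),
      |edgeGreen y (G.pt e t) - edgeGreen y (G.pt e t')| ≤ |t - t'| := by
    intro t ht t' ht'
    wlog hle : t ≤ t' generalizing t t'
    · rw [abs_sub_comm, abs_sub_comm t]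
      exact this t' ht' t ht (not_le.1 hle).le
    cases y with
    | vert v => simp [edgeGreen_vert]
    | inner e₀ s hs =>
      rw [edgeGreen_pt e₀ hs e ht, edgeGreen_pt e₀ hs e ht']
      split_ifs with he
      · subst he
        have hl := G.length_pos e
        have h1 : s * t' / G.length e - s * t / G.length e = s / G.length e * (t' - t) := by ring
        have h2 : s / G.length e ≤ 1 := (div_le_one hl).2 hs.2.le
        have h3 : 0 ≤ s / G.length e := div_nonneg hs.1.le hl.le
        have h4 : 0 ≤ s / G.length e * (t' - t) := mul_nonneg h3 (by linarith)
        have h5 : s / G.length e * (t' - t) ≤ t' - t := mul_le_of_le_one_left (by linarith) h2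
        have h6 : min s t ≤ min s t' := min_le_min le_rfl hle
        have h7 : min s t' ≤ min s t + (t' - t) := by
          rcases le_total s t with h | h
          · rw [min_eq_left h]; linarith [min_le_left s t']
          · rw [min_eq_right h]; linarith [min_le_right s t']
        rw [abs_sub_comm t, abs_of_nonneg (by linarith : 0 ≤ t' - t), abs_le]
        constructor <;> linarith
      · simp
  rw [← pt_clamp e t, ← pt_clamp e t']
  have hl := (G.length_pos e).le
  refine (key _ ⟨le_max_left _ _, max_le hl (min_le_left _ _)⟩ _
    ⟨le_max_left _ _, max_le hl (min_le_left _ _)⟩).trans ?_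
  have h1 := abs_max_sub_max_le_max (0 : ℝ) (min (G.length e) t) 0 (min (G.length e) t')
  have h2 := abs_min_sub_min_le_max (G.length e) t (G.length e) t'
  simp only [sub_self, abs_zero, abs_nonneg, max_eq_right] at h1 h2
  exact h1.trans h2

theorem continuous_hat [Fintype V] (v : V) : Continuous (hat (G := G) v) :=
  (isEdgeQuadratic_lin _).continuous

theorem continuous_edgeGreen (y : G.Point) : Continuous (edgeGreen y) := by
  cases y with
  | vert v => rw [edgeGreen_vert]; exact continuous_const
  | inner e s hs => exact (isEdgeQuadratic_edgeGreen e s hs).continuous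

theorem continuous_uncurry_greenKernel [Fintype V] [Fintype E] :
    Continuous fun p : G.Point × G.Point => greenKernel p.1 p.2 := by
  simp only [greenKernel, lin_eq_sum_hat]
  refine Continuous.add ?_ ?_
  · have := fun v => continuous_hat (G := G) v
    fun_prop
  · simp only [edgeGreen_comm _ (Prod.fst _)]
    exact continuous_uncurry_of_lipschitz edgeGreen_lipschitz continuous_edgeGreen

end JointContinuity

section LaplacianCalculus

variable {V E : Type*} [Fintype E] {G : WeightedGraph V E} {f : G.Point → ℝ}

theorem graphLap_const (r : ℝ) (u : V) : G.graphLap (fun _ => r) u = 0 := by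
  simp [graphLap, endSum]

theorem isPiecewiseC2_const (r : ℝ) : IsPiecewiseC2 fun _ : G.Point => r :=
  (funext (lin_const (G := G) r)) ▸ isPiecewiseC2_lin (G := G) fun _ => r

theorem IsPiecewiseC2.add_const (hf : IsPiecewiseC2 f) (r : ℝ) : IsPiecewiseC2 fun x => f x + r :=
  (hf.add (isPiecewiseC2_const r)).1

variable [Fintype V]

theorem laplacian_const (r : ℝ) : laplacian (fun _ : G.Point => r) = 0 := by
  have := laplacian_lin (G := G) fun _ => r
  rw [show G.lin (fun _ => r) = fun _ => r from funext (lin_const r)] at this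
  rw [this, show G.graphLap (fun _ => r) = fun _ => 0 from funext (graphLap_const r)]
  simp [vertexMass]

theorem laplacian_add_const (hf : IsPiecewiseC2 f) (r : ℝ) :
    laplacian (fun x => f x + r) = laplacian f := by
  rw [laplacian_add hf (isPiecewiseC2_const r), laplacian_const, add_zero]

theorem laplacian_sum {ι : Type*} (s : Finset ι) (w : ι → ℝ) {F : ι → G.Point → ℝ}
    (hF : ∀ i, IsPiecewiseC2 (F i)) : IsPiecewiseC2 (fun x => ∑ i ∈ s, w i * F i x) ∧
      laplacian (fun x => ∑ i ∈ s, w i * F i x) = ∑ i ∈ s, w i • laplacian (F i) := by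
  classical
  induction s using Finset.induction_on with
  | empty => simpa using ⟨isPiecewiseC2_const (G := G) 0, laplacian_const (G := G) 0⟩
  | insert i s hi ih =>
    simp only [Finset.sum_insert hi]
    exact ⟨(((hF i).const_mul _).add ih.1).1, by
      rw [laplacian_add ((hF i).const_mul _) ih.1, laplacian_const_mul (hF i), ih.2]⟩

theorem laplacian_sub {f h : G.Point → ℝ} (hf : IsPiecewiseC2 f) (hh : IsPiecewiseC2 h) :
    IsPiecewiseC2 (fun x => f x - h x) ∧
      laplacian (fun x => f x - h x) = laplacian f - laplacian h := by
  have h1 : (fun x => f x - h x) = fun x => f x + -1 * h x := by ext x; ring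
  rw [h1]
  refine ⟨(hf.add (hh.const_mul _)).1, ?_⟩
  rw [laplacian_add hf (hh.const_mul _), laplacian_const_mul hh]
  module

/-- An explicit formula for the effective resistance. -/
noncomputable def kernelResistance (y z : G.Point) : ℝ :=
  greenKernel y y + greenKernel z z - 2 * greenKernel y z

theorem isPotential_greenKernel (z y : G.Point) : IsPotential z y
    fun x => greenKernel x y - greenKernel x z + -(greenKernel z y - greenKernel z z) := by
  have h := laplacian_sub (isPiecewiseC2_greenKernel y) (isPiecewiseC2_greenKernel z)
  refine ⟨h.1.add_const _, ?_, by ring⟩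
  rw [laplacian_add_const h.1, h.2, laplacian_greenKernel, laplacian_greenKernel]
  abel

/-- The kernel supplies a potential, so the chosen one is a genuine potential too; both have the
same Laplacian and vanish at `z`, hence they agree. -/
theorem resistance_eq (y z : G.Point) : resistance y z = kernelResistance y z := by
  have h1 := isPotential_greenKernel z y
  have h2 : IsPotential z y (potential z y) := Classical.epsilon_spec ⟨_, h1⟩
  have h3 := sub_eq_sub_of_laplacian_eq h2.1 h1.1 (h2.2.1.trans h1.2.1.symm) y z
  rw [h2.2.2] at h3
  rw [resistance, kernelResistance]
  linarith [greenKernel_comm y z]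

/-- The measure `ν` cancels in the Laplacian of `gr · y - gr · z`, so every Green's function yields
the same resistance. -/
theorem IsGreen.kernelResistance_eq {ν : SignedMeasure G.Point} {gr : G.Point → G.Point → ℝ}
    (h : IsGreen ν gr) (y z : G.Point) :
    kernelResistance y z = gr y y + gr z z - 2 * gr y z := by
  have h1 := isPotential_greenKernel z y
  have h2 := laplacian_sub (h.domain y) (h.domain z)
  have h3 := sub_eq_sub_of_laplacian_eq h2.1 h1.1 (by
    rw [h2.2, h1.2.1, h.laplacian_eq, h.laplacian_eq]; abel) y z
  rw [kernelResistance]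
  linarith [greenKernel_comm y z, h.symm y z]

end LaplacianCalculus

/-! ### Integration against edgewise constant densities. -/

section EdgeIntegral

variable {V E : Type*} [Fintype E] {G : WeightedGraph V E} {f h : G.Point → ℝ}

/-- The integral against the measure with constant density `c e` on each edge `e`. -/
noncomputable def edgeIntegral (c : E → ℝ) (f : G.Point → ℝ) : ℝ :=
  ∑ e, c e * ∫ t in (0 : ℝ)..G.length e, f (G.pt e t)

theorem integral_edgeDensity_eq (hf : Continuous f) (c : E → ℝ) :
    ∫ᵛ x, f x ∂•(G.edgeDensity c) = edgeIntegral c f :=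
  integral_edgeDensity hf c

theorem edgeIntegral_add (c : E → ℝ) (hf : Continuous f) (hh : Continuous h) :
    edgeIntegral c (fun x => f x + h x) = edgeIntegral c f + edgeIntegral c h := by
  rw [edgeIntegral, edgeIntegral, edgeIntegral, ← Finset.sum_add_distrib]
  refine Finset.sum_congr rfl fun e _ => ?_
  have hf' : Continuous fun t => f (G.pt e t) := hf.comp (continuous_pt e)
  have hh' : Continuous fun t => h (G.pt e t) := hh.comp (continuous_pt e)
  rw [intervalIntegral.integral_add (hf'.intervalIntegrable _ _) (hh'.intervalIntegrable _ _),
    mul_add]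

theorem edgeIntegral_const_mul (c : E → ℝ) (r : ℝ) (f : G.Point → ℝ) :
    edgeIntegral c (fun x => r * f x) = r * edgeIntegral c f := by
  rw [edgeIntegral, edgeIntegral, Finset.mul_sum]
  refine Finset.sum_congr rfl fun e _ => ?_
  rw [intervalIntegral.integral_const_mul]; ring

theorem edgeIntegral_const (c : E → ℝ) (r : ℝ) :
    edgeIntegral c (fun _ : G.Point => r) = r * ∑ e, c e * G.length e := by
  simp only [edgeIntegral, intervalIntegral.integral_const, smul_eq_mul, Finset.mul_sum]
  exact Finset.sum_congr rfl fun e _ => by ring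

theorem edgeIntegral_sum {ι : Type*} (s : Finset ι) (c : E → ℝ) (w : ι → ℝ)
    {F : ι → G.Point → ℝ} (hF : ∀ i, Continuous (F i)) :
    edgeIntegral c (fun x => ∑ i ∈ s, w i * F i x) = ∑ i ∈ s, w i * edgeIntegral c (F i) := by
  classical
  induction s using Finset.induction_on with
  | empty => simp [edgeIntegral]
  | insert i s hi ih =>
    simp only [Finset.sum_insert hi]
    have h1 : Continuous fun x => w i * F i x := continuous_const.mul (hF i)
    have h2 : Continuous fun x => ∑ i ∈ s, w i * F i x :=
      continuous_finsetSum _ fun i _ => continuous_const.mul (hF i)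
    rw [edgeIntegral_add c h1 h2, edgeIntegral_const_mul, ih]

theorem edgeIntegral_lin (c : E → ℝ) (a : V → ℝ) : edgeIntegral c (G.lin a) =
    ∑ e, c e * G.length e * ((a (G.src e) + a (G.tgt e)) / 2) := by
  simp only [edgeIntegral, integral_lin_pt, mul_assoc]

end EdgeIntegral

/-! ### Existence and uniqueness of the admissible measure for zero weights. -/

section Canonical

variable {V E : Type*} [Fintype V] [Fintype E] (G : WeightedGraph V E)

/-- The sum of the Foster coefficients, which is the first Betti number. -/
noncomputable def fosterSum : ℝ := ∑ e, G.foster e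

/-- The density of the admissible measure with respect to the canonical divisor. -/
noncomputable def canonicalDensity (e : E) : ℝ := G.fosterSum⁻¹ * (G.foster e / G.length e)

/-- The coefficients of the canonical divisor of `(Γ, 0)`. -/
noncomputable def valenceCoeff (v : V) : ℝ := G.vertexValence v - 2

/-- A function whose Laplacian is the difference of the admissible measure and the uniform measure
on the vertices. -/
noncomputable def canonicalPotential (x : G.Point) : ℝ :=
  G.lin (fun u => (2 * G.fosterSum)⁻¹ *
    (G.discreteGreen u u + ∑ v, G.valenceCoeff v * G.discreteGreen u v)) x +
      G.bubble G.canonicalDensity x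

variable {G}

theorem sum_valenceCoeff : ∑ v, G.valenceCoeff v = 2 * G.fosterSum - 2 := by
  simp only [valenceCoeff, Finset.sum_sub_distrib, sum_vertexValence, fosterSum, sum_foster]
  simp; ring

theorem sum_canonicalDensity (hg : G.fosterSum ≠ 0) :
    ∑ e, G.canonicalDensity e * G.length e = 1 := by
  have : ∀ e, G.canonicalDensity e * G.length e = G.fosterSum⁻¹ * G.foster e := fun e => by
    rw [canonicalDensity]
    field_simp [(G.length_pos e).ne']
  simp only [this, ← Finset.mul_sum]
  exact inv_mul_cancel₀ hg

theorem isPiecewiseC2_canonicalPotential : IsPiecewiseC2 G.canonicalPotential :=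
  ((isPiecewiseC2_lin _).add (isPiecewiseC2_bubble _)).1

/-- The term 2 minus the valence from the diagonal cancels the coefficient of the canonical divisor;
the uniform contributions add up to `2 * G.fosterSum / Fintype.card V`. -/
theorem graphLap_canonicalPotential (hg : G.fosterSum ≠ 0) (u : V) :
    G.graphLap (fun u => (2 * G.fosterSum)⁻¹ *
      (G.discreteGreen u u + ∑ v, G.valenceCoeff v * G.discreteGreen u v)) u =
    (2 * G.fosterSum)⁻¹ * G.endSum G.foster G.foster u - 1 / Fintype.card V := by
  classical
  have hn := (card_vertex_pos G).ne'
  rw [graphLap_const_mul, graphLap_add, graphLap_diag_discreteGreen, graphLap_sum]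
  simp only [graphLap_const_mul, graphLap_discreteGreen, mul_sub, Finset.sum_sub_distrib,
    ← Finset.sum_mul, sum_valenceCoeff]
  simp only [mul_ite, mul_one, mul_zero, Finset.sum_ite_eq, Finset.mem_univ, if_true, valenceCoeff]
  field_simp
  ring

theorem laplacian_canonicalPotential (hg : G.fosterSum ≠ 0) : laplacian G.canonicalPotential =
    G.edgeDensity G.canonicalDensity - G.vertexMass fun _ => 1 / Fintype.card V := by
  have h1 : laplacian G.canonicalPotential = _ :=
    laplacian_add (isPiecewiseC2_lin _) (isPiecewiseC2_bubble _)
  have h2 : G.endSum (fun e => G.canonicalDensity e * G.length e / 2)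
      (fun e => G.canonicalDensity e * G.length e / 2) =
        fun u => (2 * G.fosterSum)⁻¹ * G.endSum G.foster G.foster u := by
    ext u
    rw [← endSum_const_mul]
    congr 1 <;>
    · ext e
      rw [canonicalDensity]
      have := (G.length_pos e).ne'
      field_simp
  rw [h1, laplacian_lin, laplacian_bubble, funext (graphLap_canonicalPotential hg), h2]
  simp only [sub_eq_add_neg, vertexMass_add, vertexMass_neg]
  abel

theorem canonicalPotential_eq (hg : G.fosterSum ≠ 0) (x : G.Point) :
    2 * G.fosterSum * G.canonicalPotential x =
      greenKernel x x + ∑ v, G.valenceCoeff v * greenKernel x (.vert v) := by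
  rw [canonicalPotential, greenKernel_diag, lin_const_mul, lin_add, lin_sum]
  simp only [greenKernel_vert, lin_const_mul]
  have : 2 * G.fosterSum * G.bubble G.canonicalDensity x =
      G.bubble (fun e => 2 * (G.foster e / G.length e)) x := by
    cases x with
    | vert v => simp [bubble]
    | inner e t ht =>
      simp only [bubble, canonicalDensity]
      field_simp
  rw [mul_add, this, mul_inv_cancel_left₀ (by simpa using hg)]
  ring

/-- The integral has the same bubble part as `canonicalPotential`, and its vertex values have the
same discrete Laplacian, so the two differ by a constant. -/
theorem exists_edgeIntegral_greenKernel (hg : G.fosterSum ≠ 0) : ∃ r, ∀ y : G.Point,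
    edgeIntegral G.canonicalDensity (fun x => greenKernel x y) = G.canonicalPotential y + r := by
  classical
  set P : V → ℝ := fun u => ∑ e, (2 * G.fosterSum)⁻¹ * G.foster e *
    (G.discreteGreen u (G.src e) + G.discreteGreen u (G.tgt e)) with hP
  have hlap : ∀ u, G.graphLap P u =
      (2 * G.fosterSum)⁻¹ * G.endSum G.foster G.foster u - 1 / Fintype.card V := by
    intro u
    have hn := (card_vertex_pos G).ne'
    rw [hP, graphLap_sum]
    simp only [graphLap_const_mul, graphLap_add, graphLap_discreteGreen]
    have h1 : G.endSum G.foster G.foster u = ∑ e, G.foster e *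
        ((if u = G.src e then 1 else 0) + (if u = G.tgt e then 1 else 0)) := by
      simp only [endSum, Finset.sum_filter, mul_add, mul_ite, mul_one, mul_zero,
        Finset.sum_add_distrib, eq_comm]
    have h2 : ∀ e, (2 * G.fosterSum)⁻¹ * G.foster e * ((if u = G.src e then 1 else 0) -
        1 / (Fintype.card V : ℝ) + ((if u = G.tgt e then 1 else 0) - 1 / (Fintype.card V : ℝ))) =
        (2 * G.fosterSum)⁻¹ * (G.foster e *
        ((if u = G.src e then 1 else 0) + (if u = G.tgt e then 1 else 0))) -
          (2 * G.fosterSum)⁻¹ * (2 / Fintype.card V) * G.foster e := fun e => by ring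
    rw [h1, Finset.sum_congr rfl fun e _ => h2 e, Finset.sum_sub_distrib, ← Finset.mul_sum,
      ← Finset.mul_sum, ← fosterSum]
    field_simp
  obtain ⟨v₀⟩ := G.nonempty
  set b : V → ℝ := fun u => (2 * G.fosterSum)⁻¹ *
    (G.discreteGreen u u + ∑ v, G.valenceCoeff v * G.discreteGreen u v) with hb
  have hPb : P = fun u => b u + (P v₀ - b v₀) := by
    ext u
    have := eq_of_graphLap_eq (G := G) (a := P) (b := b)
      (fun u => (hlap u).trans (graphLap_canonicalPotential hg u).symm) u v₀
    linarith
  refine ⟨P v₀ - b v₀, fun y => ?_⟩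
  have h1 : edgeIntegral G.canonicalDensity (fun x => greenKernel x y) =
      G.lin P y + G.bubble G.canonicalDensity y := by
    simp only [greenKernel]
    rw [edgeIntegral_add _ (isPiecewiseC2_lin _).1 (continuous_edgeGreen y), edgeIntegral_lin]
    congr 1
    · rw [hP, lin_sum]
      refine Finset.sum_congr rfl fun e _ => ?_
      rw [lin_const_mul, lin_add, canonicalDensity]
      have := (G.length_pos e).ne'
      have h3 : ∀ v, G.lin (fun u => G.discreteGreen u v) y = G.lin (G.discreteGreen v) y :=
        fun v => by congr 1; ext u; exact discreteGreen_comm _ _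
      rw [h3, h3]
      field_simp
    · exact sum_integral_edgeGreen _ y
  rw [h1, hPb, lin_add, lin_const, canonicalPotential]
  ring

/-- Subtracting the potential symmetrically in both variables replaces the uniform measure by the
canonical one; `C` is fixed by the normalization of the integral. -/
theorem exists_isGreen_canonical (hg : G.fosterSum ≠ 0) :
    ∃ C, IsGreen (G.edgeDensity G.canonicalDensity) fun x y =>
      greenKernel x y - (G.canonicalPotential x + (G.canonicalPotential y - C)) := by
  obtain ⟨r, hr⟩ := exists_edgeIntegral_greenKernel hg
  set κ := edgeIntegral G.canonicalDensity G.canonicalPotential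
  have hH := isPiecewiseC2_canonicalPotential (G := G)
  have hHc := hH.1
  have hdom : ∀ y s, _ := fun (y : G.Point) (s : ℝ) =>
    laplacian_sub (isPiecewiseC2_greenKernel y) (hH.add_const s)
  refine ⟨κ - r, ⟨?_, fun x y => ?_, fun y => (hdom y _).1, fun y => ?_, fun y => ?_⟩⟩
  · have := continuous_uncurry_greenKernel (G := G)
    fun_prop
  · rw [greenKernel_comm]; ring
  · rw [(hdom y _).2, laplacian_greenKernel, laplacian_add_const hH, laplacian_canonicalPotential hg]
    abel
  · rw [integral_edgeDensity_eq (hdom y _).1.1]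
    have h1 : (fun x => greenKernel x y - (G.canonicalPotential x +
        (G.canonicalPotential y - (κ - r)))) = fun x => greenKernel x y + (-1 *
          G.canonicalPotential x + -(G.canonicalPotential y - (κ - r))) := by ext x; ring
    rw [h1, edgeIntegral_add _ (isPiecewiseC2_greenKernel y).1 (by fun_prop),
      edgeIntegral_add _ (by fun_prop) (by fun_prop), edgeIntegral_const_mul, edgeIntegral_const,
      sum_canonicalDensity hg, hr]
    ring

variable {D : G.Divisor}

/-- In $g(x,x)+g(x,K)$ the potential occurs $2+\deg K=2g$ times, exactly cancelling $k(x,x)+k(x,K)$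
by `canonicalPotential_eq`. -/
theorem isAdmissible_canonical (hg : G.fosterSum ≠ 0)
    (hD : ∀ f, evalDivisor D f = ∑ v, G.valenceCoeff v * f (.vert v)) :
    IsAdmissible D (G.edgeDensity G.canonicalDensity) := by
  obtain ⟨C, hC⟩ := exists_isGreen_canonical hg
  refine ⟨?_, _, hC, -∑ v, G.valenceCoeff v * (G.canonicalPotential (.vert v) - C) + C, fun x => ?_⟩
  · simp only [edgeDensity_apply _ MeasurableSet.univ, edgeMeasure_univ, sum_canonicalDensity hg]
  · have h1 := canonicalPotential_eq hg x
    rw [hD]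
    simp only [mul_sub, mul_add, Finset.sum_sub_distrib, Finset.sum_add_distrib, ← Finset.sum_mul,
      sum_valenceCoeff] at h1 ⊢
    linarith

/-- Admissibility gives $r(x,K)=2g\,g_\nu(x,x)+\text{const}$. The left side does not involve $\nu$,
so for $g\ne0$ the diagonal, and then $g_\nu(x,K)$, is determined up to a constant. The Laplacian of
the latter is $\delta_K-(2g-2)\nu$, which recovers $\nu$ when $g\ne1$. -/
theorem IsAdmissible.eq_of_canonical (hg : G.fosterSum ≠ 0) (hg1 : G.fosterSum ≠ 1)
    (hD : ∀ f, evalDivisor D f = ∑ v, G.valenceCoeff v * f (.vert v))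
    {ν ν' : SignedMeasure G.Point} (h : IsAdmissible D ν) (h' : IsAdmissible D ν') : ν = ν' := by
  have diag : ∀ {ν : SignedMeasure G.Point} {gr : G.Point → G.Point → ℝ} {a : ℝ}, IsGreen ν gr →
      (∀ x, gr x x + evalDivisor D (gr x) = a) → ∀ x,
      ∑ v, G.valenceCoeff v * kernelResistance x (.vert v) = 2 * G.fosterSum * gr x x +
        ((∑ v, G.valenceCoeff v * gr (.vert v) (.vert v)) - 2 * a) := by
    intro ν gr a hgr ha x
    have h1 := ha x
    rw [hD] at h1
    simp only [hgr.kernelResistance_eq, mul_sub, mul_add, Finset.sum_sub_distrib,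
      Finset.sum_add_distrib, ← Finset.sum_mul, sum_valenceCoeff, mul_left_comm _ (2 : ℝ),
      ← Finset.mul_sum]
    linarith
  have lap : ∀ {ν : SignedMeasure G.Point} {gr : G.Point → G.Point → ℝ}, IsGreen ν gr →
      IsPiecewiseC2 (fun x => ∑ v, G.valenceCoeff v * gr x (.vert v)) ∧
      laplacian (fun x => ∑ v, G.valenceCoeff v * gr x (.vert v)) =
        (∑ v, G.valenceCoeff v • (VectorMeasure.dirac (.vert v) 1 : SignedMeasure G.Point)) -
          (2 * G.fosterSum - 2) • ν := by
    intro ν gr hgr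
    have h1 := laplacian_sum Finset.univ G.valenceCoeff (fun v => hgr.domain (.vert v))
    refine ⟨h1.1, ?_⟩
    rw [h1.2, ← sum_valenceCoeff, Finset.sum_smul, ← Finset.sum_sub_distrib]
    refine Finset.sum_congr rfl fun v _ => ?_
    rw [hgr.laplacian_eq, smul_sub]
  obtain ⟨-, gr, hgr, a, ha⟩ := h
  obtain ⟨-, gr', hgr', a', ha'⟩ := h'
  obtain ⟨r, hr⟩ : ∃ r, ∀ x, gr x x = gr' x x + r := by
    refine ⟨(2 * G.fosterSum)⁻¹ * ((∑ v, G.valenceCoeff v * gr' (.vert v) (.vert v)) - 2 * a' -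
      ((∑ v, G.valenceCoeff v * gr (.vert v) (.vert v)) - 2 * a)), fun x => ?_⟩
    have h1 := diag hgr ha x
    have h2 := diag hgr' ha' x
    field_simp
    linarith
  have hsum : (fun x => ∑ v, G.valenceCoeff v * gr x (.vert v)) =
      fun x => (∑ v, G.valenceCoeff v * gr' x (.vert v)) + (a - a' - r) := by
    ext x
    have h1 := ha x
    have h2 := ha' x
    rw [hD] at h1 h2
    linarith [hr x]
  have h1 := (lap hgr).2
  rw [hsum, laplacian_add_const (lap hgr').1, (lap hgr').2, sub_right_inj] at h1
  have hne : 2 * G.fosterSum - 2 ≠ 0 := fun h => hg1 (by linarith)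
  exact (smul_right_injective _ hne h1).symm

theorem admissibleMeasure_canonical (hg : G.fosterSum ≠ 0) (hg1 : G.fosterSum ≠ 1)
    (hD : ∀ f, evalDivisor D f = ∑ v, G.valenceCoeff v * f (.vert v)) :
    admissibleMeasure D = G.edgeDensity G.canonicalDensity :=
  have h := isAdmissible_canonical hg hD
  IsAdmissible.eq_of_canonical hg hg1 hD (Classical.epsilon_spec ⟨_, h⟩) h

end Canonical

end WeightedGraph

/-! ### Symmetric polynomials in the lengths, positivity of η, and the Betti number. -/

namespace WeightedGraph

section Symmetric

variable {V E : Type*} [Fintype E] (G : WeightedGraph V E)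

theorem two_mul_sigma_two :
    2 * G.sigma 2 = (∑ e, G.length e) ^ 2 - ∑ e, G.length e ^ 2 := by
  have h := congrArg (MvPolynomial.eval G.length) (MvPolynomial.mul_esymm_eq_sum E ℝ 2)
  rw [show (Finset.HasAntidiagonal.antidiagonal 2 : Finset (ℕ × ℕ)).filter (fun a => a.1 < 2) = {(0, 2), (1, 1)} by
    ext ⟨a, b⟩
    simp only [Finset.mem_filter, Finset.HasAntidiagonal.mem_antidiagonal, Finset.mem_insert,
      Finset.mem_singleton, Prod.mk.injEq]
    omega] at h
  simp [MvPolynomial.esymm_one, MvPolynomial.psum] at h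
  rw [sigma, h]; ring

theorem six_mul_sigma_three : 6 * G.sigma 3 = (∑ e, G.length e) ^ 3 -
    3 * (∑ e, G.length e) * (∑ e, G.length e ^ 2) + 2 * ∑ e, G.length e ^ 3 := by
  have h := congrArg (MvPolynomial.eval G.length) (MvPolynomial.mul_esymm_eq_sum E ℝ 3)
  rw [show (Finset.HasAntidiagonal.antidiagonal 3 : Finset (ℕ × ℕ)).filter (fun a => a.1 < 3) = {(0, 3), (1, 2), (2, 1)} by
    
    ext ⟨a, b⟩
    simp only [Finset.mem_filter, Finset.HasAntidiagonal.mem_antidiagonal, Finset.mem_insert,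
      Finset.mem_singleton, Prod.mk.injEq]
    omega] at h
  have h2 := G.two_mul_sigma_two
  rw [sigma] at h2
  simp [MvPolynomial.esymm_one, MvPolynomial.psum] at h
  rw [sigma]
  linear_combination 2 * h + (∑ e, G.length e) * h2

/-- Twice the difference of the two sides is $\sum_i\sum_{j,k\ne i}\ell_i(\ell_j-\ell_k)^2\ge0$;
expressing everything in power sums verifies this. -/
theorem card_mul_sigma_three_le :
    3 * (Fintype.card E : ℝ) * G.sigma 3 ≤ (Fintype.card E - 2) * (G.totalLength * G.sigma 2) := by
  classical
  set m : ℝ := (Fintype.card E : ℝ)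
  set p1 := ∑ e, G.length e with hp1
  set p2 := ∑ e, G.length e ^ 2 with hp2
  set p3 := ∑ e, G.length e ^ 3 with hp3
  have key : 0 ≤ 2 * ((m + 1) * p1 * p2 - p1 ^ 3 - m * p3) := by
    have h1 : ∀ i, ∑ j ∈ Finset.univ.erase i, ∑ k ∈ Finset.univ.erase i,
        G.length i * (G.length j - G.length k) ^ 2 =
        2 * m * G.length i * p2 - 2 * G.length i * p1 ^ 2 -
          2 * (m * G.length i ^ 3 - 2 * G.length i ^ 2 * p1 + G.length i * p2) := by
      intro i
      have e1 : ∀ f : E → ℝ, ∑ j ∈ Finset.univ.erase i, f j = ∑ j, f j - f i := fun f => by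
        rw [← Finset.add_sum_erase _ f (Finset.mem_univ i)]; ring
      simp only [e1]
      have e2 : ∀ j, ∑ k, G.length i * (G.length j - G.length k) ^ 2 =
          m * G.length i * G.length j ^ 2 - 2 * G.length i * p1 * G.length j +
            G.length i * p2 := by
        intro j
        have : ∀ k, G.length i * (G.length j - G.length k) ^ 2 = G.length i * G.length j ^ 2 -
            2 * G.length i * G.length j * G.length k + G.length i * G.length k ^ 2 := fun k => by
          ring
        simp only [this, Finset.sum_add_distrib, Finset.sum_sub_distrib, ← Finset.mul_sum,
          Finset.sum_const, Finset.card_univ, nsmul_eq_mul]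
        ring
      have e3 : ∑ j, G.length i * (G.length j - G.length i) ^ 2 =
          m * G.length i ^ 3 - 2 * G.length i ^ 2 * p1 + G.length i * p2 := by
        rw [Finset.sum_congr rfl fun j _ => show G.length i * (G.length j - G.length i) ^ 2 =
          G.length i * (G.length i - G.length j) ^ 2 by ring, e2]
        ring
      simp only [e2, e3, Finset.sum_sub_distrib, Finset.sum_add_distrib, ← Finset.mul_sum,
        Finset.sum_const, Finset.card_univ, nsmul_eq_mul]
      ring
    have h2 : ∑ i, ∑ j ∈ Finset.univ.erase i, ∑ k ∈ Finset.univ.erase i,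
        G.length i * (G.length j - G.length k) ^ 2 =
        2 * ((m + 1) * p1 * p2 - p1 ^ 3 - m * p3) := by
      simp only [h1]
      have : ∀ i, 2 * m * G.length i * p2 - 2 * G.length i * p1 ^ 2 -
          2 * (m * G.length i ^ 3 - 2 * G.length i ^ 2 * p1 + G.length i * p2) =
          (2 * m * p2 - 2 * p1 ^ 2 - 2 * p2) * G.length i - 2 * m * G.length i ^ 3 +
            4 * p1 * G.length i ^ 2 := fun i => by ring
      simp only [this, Finset.sum_add_distrib, Finset.sum_sub_distrib, ← Finset.mul_sum, ← hp1,
        ← hp2, ← hp3]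
      ring
    rw [← h2]
    exact Finset.sum_nonneg fun i _ => Finset.sum_nonneg fun j _ => Finset.sum_nonneg fun k _ =>
      mul_nonneg (G.length_pos i).le (sq_nonneg _)
  have h2 := G.two_mul_sigma_two
  have h3 := G.six_mul_sigma_three
  rw [← hp1, ← hp2] at h2
  rw [← hp1, ← hp2, ← hp3] at h3
  have h4 : 2 * ((m - 2) * (p1 * G.sigma 2)) - 2 * (3 * m * G.sigma 3) =
      2 * ((m + 1) * p1 * p2 - p1 ^ 3 - m * p3) := by
    linear_combination (m - 2) * p1 * h2 - m * h3
  change _ ≤ (m - 2) * (p1 * G.sigma 2)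
  linarith

theorem sigma_two_pos (h : 2 ≤ Fintype.card E) : 0 < G.sigma 2 := by
  rw [sigma, MvPolynomial.esymm, map_sum]
  refine Finset.sum_pos (fun s _ => ?_) (Finset.powersetCard_nonempty.2 (by simpa using h))
  rw [map_prod]
  exact Finset.prod_pos fun e _ => by simpa using G.length_pos e

/-- A minimal connecting edge set is a spanning tree. This gives `eta_pos`, so that dividing by η is
legitimate. -/
theorem exists_isSpanningTree : ∃ T, G.IsSpanningTree T := by
  classical
  have huniv : G.ConnectedBy Finset.univ := fun u v => by simpa using G.connected u v
  obtain ⟨T, hT, hmin⟩ := (Set.toFinite {T : Finset E | G.ConnectedBy T}).exists_minimal ⟨_, huniv⟩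
  refine ⟨T, hT, fun e he h => ?_⟩
  have := hmin h (T.erase_subset e) he
  simp at this

theorem eta_pos : 0 < G.eta := by
  classical
  obtain ⟨T, hT⟩ := G.exists_isSpanningTree
  exact Finset.sum_pos (fun T _ => Finset.prod_pos fun e _ => G.length_pos e)
    ⟨T, by simpa using hT⟩

theorem firstBetti_eq [Fintype V] :
    (G.firstBetti : ℝ) = Fintype.card E - Fintype.card V + 1 := by
  have h1 := Submodule.finrank_quotient_add_finrank (LinearMap.range G.coboundary)
  have h2 := LinearMap.finrank_range_add_finrank_ker G.coboundary
  have h3 : LinearMap.ker G.coboundary = Submodule.span ℝ {fun _ => (1 : ℝ)} := by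
    ext a
    rw [LinearMap.mem_ker, Submodule.mem_span_singleton]
    constructor
    · intro h
      obtain ⟨v⟩ := G.nonempty
      refine ⟨a v, funext fun u => ?_⟩
      have h4 : ∀ e, a (G.src e) = a (G.tgt e) := fun e =>
        (sub_eq_zero.1 (congrFun h e)).symm
      simpa using eq_of_forall_edge h4 v u
    · rintro ⟨c, rfl⟩
      ext e
      simp [coboundary]
  obtain ⟨v⟩ := G.nonempty
  have h5 : Module.finrank ℝ (LinearMap.ker G.coboundary) = 1 := by
    rw [h3]
    exact finrank_span_singleton fun h => one_ne_zero (congrFun h v)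
  rw [h5, Module.finrank_fintype_fun_eq_card] at h2
  rw [Module.finrank_fintype_fun_eq_card] at h1
  rw [firstBetti]
  have h1' : (Module.finrank ℝ G.H1 : ℝ) + Module.finrank ℝ (LinearMap.range G.coboundary) =
    Fintype.card E := by exact_mod_cast h1
  have h2' : (Module.finrank ℝ (LinearMap.range G.coboundary) : ℝ) + 1 = Fintype.card V := by
    exact_mod_cast h2
  linarith

end Symmetric

/-! ### The invariants ε and τ in terms of resistances between vertices. -/

section Invariants

variable {V E : Type*} [Fintype V] [Fintype E] {G : WeightedGraph V E}

theorem kernelResistance_comm (x y : G.Point) : kernelResistance x y = kernelResistance y x := by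
  rw [kernelResistance, kernelResistance, greenKernel_comm x y]; ring

theorem continuous_kernelResistance (y : G.Point) : Continuous fun x => kernelResistance x y := by
  have h1 := continuous_uncurry_greenKernel (G := G)
  unfold kernelResistance
  have h2 : Continuous fun x : G.Point => greenKernel x x := h1.comp (continuous_id.prodMk continuous_id)
  have h3 := (isPiecewiseC2_greenKernel y).1
  fun_prop

theorem foster_eq (e : E) : G.foster e =
    1 - kernelResistance (G := G) (.vert (G.src e)) (.vert (G.tgt e)) / G.length e := by
  simp only [foster, kernelResistance, greenKernel_vert, lin]

/-- By `greenKernel_diag`, resistance to a vertex is a linear interpolation plus a bubble with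
coefficient $2F_e/\ell_e$. The two parts integrate to endpoint averages and to the $F_e^2\ell_e/6$
terms. -/
theorem edgeIntegral_kernelResistance (hg : G.fosterSum ≠ 0) (v : V) :
    edgeIntegral G.canonicalDensity (fun x : G.Point => kernelResistance x (.vert v)) =
      G.fosterSum⁻¹ * ((∑ e, G.foster e * (kernelResistance (G := G) (.vert v) (.vert (G.src e)) +
        kernelResistance (G := G) (.vert v) (.vert (G.tgt e)))) / 2 +
          (∑ e, G.foster e ^ 2 * G.length e) / 6) := by
  set a : V → ℝ := fun u => kernelResistance (G := G) (.vert v) (.vert u)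
  have h1 : (fun x : G.Point => kernelResistance x (.vert v)) = fun x =>
      G.lin a x + G.bubble (fun e => 2 * (G.foster e / G.length e)) x := by
    ext x
    have h2 : a = fun u => (G.discreteGreen u u + G.discreteGreen v v) +
        -2 * G.discreteGreen u v := by
      ext u
      simp only [a, kernelResistance, greenKernel_vert, lin, discreteGreen_comm v u]; ring
    rw [h2, lin_add, lin_add, lin_const_mul, lin_const, kernelResistance, greenKernel_diag,
      greenKernel_vert, greenKernel_vert]
    simp only [lin]
    ring
  rw [h1, edgeIntegral_add _ (isPiecewiseC2_lin _).1 (isPiecewiseC2_bubble _).1, edgeIntegral_lin,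
    edgeIntegral]
  simp only [integral_bubble_pt, mul_add, Finset.sum_div, Finset.mul_sum, ← Finset.sum_add_distrib]
  refine Finset.sum_congr rfl fun e _ => ?_
  have := (G.length_pos e).ne'
  rw [canonicalDensity]
  field_simp
  ring

variable {D : G.Divisor}

/-- The identity expressing `τ` through `ε` and `θ = ∑ K(u) K(v) r(u, v)`. -/
theorem integral_kernelResistance (hg : G.fosterSum ≠ 0)
    (hD : ∀ f, evalDivisor D f = ∑ v, G.valenceCoeff v * f (.vert v)) :
    (Continuous fun y : G.Point =>
      edgeIntegral G.canonicalDensity fun x => kernelResistance x y) ∧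
    8 * G.fosterSum * (G.fosterSum - 1) * (1 / 2 * edgeIntegral G.canonicalDensity fun y : G.Point =>
        edgeIntegral G.canonicalDensity fun x => kernelResistance x y) =
      (4 * G.fosterSum - 2) * (∑ v, G.valenceCoeff v *
        edgeIntegral G.canonicalDensity fun x : G.Point => kernelResistance x (.vert v)) -
      ∑ u, ∑ v, G.valenceCoeff u * G.valenceCoeff v * kernelResistance (G := G) (.vert u) (.vert v) := by
  obtain ⟨-, gr, hgr, a, ha⟩ := isAdmissible_canonical hg hD
  set c := G.canonicalDensity
  have hint : ∀ y, edgeIntegral c (fun x => gr x y) = 0 := fun y => by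
    rw [← integral_edgeDensity_eq (hgr.domain y).1]
    exact hgr.integral_eq_zero y
  have hdiag : Continuous fun x => gr x x := hgr.continuous.comp (continuous_id.prodMk continuous_id)
  have hone : ∀ r, edgeIntegral c (fun _ : G.Point => r) = r := fun r => by
    rw [edgeIntegral_const, sum_canonicalDensity hg, mul_one]
  set T := edgeIntegral c fun x => gr x x with hT
  -- In $r(x,y)=g_\mu(x,x)+g_\mu(y,y)-2g_\mu(x,y)$ the cross term integrates to 0, so a second
  -- integration gives $\tau=T$.
  have hI : ∀ y, edgeIntegral c (fun x => kernelResistance x y) = T + gr y y := by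
    intro y
    have h1 : (fun x => kernelResistance x y) = fun x => (gr x x + gr y y) + -2 * gr x y := by
      ext x; rw [hgr.kernelResistance_eq]; ring
    have h2 := (hgr.domain y).1
    have h3 : Continuous fun x => gr x x + gr y y := hdiag.add continuous_const
    rw [h1, edgeIntegral_add c h3 (by fun_prop),
      edgeIntegral_add c hdiag (by fun_prop),
      edgeIntegral_const_mul, hint, hone]
    ring
  have hII : edgeIntegral c (fun y : G.Point => edgeIntegral c fun x => kernelResistance x y) = 2 * T := by
    simp only [hI]
    rw [edgeIntegral_add c (by fun_prop) hdiag, hone]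
    ring
  -- Integrating the admissibility equation identifies its constant, since $g_\mu(x,K)$ integrates
  -- to 0.
  have haT : a = T := by
    have h1 : edgeIntegral c (fun x => gr x x + ∑ v, G.valenceCoeff v * gr x (.vert v)) = a := by
      rw [← hone a]
      congr 1
      ext x
      rw [← ha x, hD]
    have h2 : ∀ v : V, Continuous fun x => gr x (.vert v) := fun v => (hgr.domain _).1
    rw [edgeIntegral_add c hdiag (by fun_prop), edgeIntegral_sum _ _ _ h2] at h1
    simpa [hint] using h1.symm
  set S := ∑ v, G.valenceCoeff v * gr (.vert v) (.vert v)
  have hdeg := sum_valenceCoeff (G := G)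
  -- Admissibility at $u$ replaces $g_\mu(u,K)$ by $T-g_\mu(u,u)$, so θ depends only on $S$ and $T$.
  have hθ : ∑ u, ∑ v, G.valenceCoeff u * G.valenceCoeff v * kernelResistance (G := G) (.vert u) (.vert v) =
      (4 * G.fosterSum - 2) * S - (4 * G.fosterSum - 4) * T := by
    have h1 : ∀ u, ∑ v, G.valenceCoeff u * G.valenceCoeff v *
        kernelResistance (G := G) (.vert u) (.vert v) =
        2 * G.fosterSum * (G.valenceCoeff u * gr (.vert u) (.vert u)) +
          G.valenceCoeff u * (S - 2 * T) := by
      intro u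
      have h2 := ha (.vert u)
      rw [hD, haT] at h2
      have h3 : ∑ v, G.valenceCoeff v * kernelResistance (G := G) (.vert u) (.vert v) =
          2 * G.fosterSum * gr (.vert u) (.vert u) + (S - 2 * T) := by
        simp only [hgr.kernelResistance_eq, mul_sub, mul_add, Finset.sum_sub_distrib,
          Finset.sum_add_distrib, ← Finset.sum_mul, hdeg, mul_left_comm _ (2 : ℝ),
          ← Finset.mul_sum]
        linarith
      simp only [mul_assoc, ← Finset.mul_sum]
      rw [h3]; ring
    simp only [h1, Finset.sum_add_distrib, ← Finset.mul_sum, ← Finset.sum_mul, hdeg]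
    ring
  refine ⟨by simp only [hI]; exact continuous_const.add hdiag, ?_⟩
  rw [hII, hθ]
  simp only [hI, mul_add, Finset.sum_add_distrib, ← Finset.sum_mul, hdeg]
  ring

end Invariants

end WeightedGraph

/-! ### The exact formula for φ and the final estimate. -/

namespace PMGraph

open WeightedGraph

variable {V E : Type*} [Fintype V] [Fintype E] (Γ : PMGraph V E)

theorem canonicalCoeff_of_q_eq_zero (hq : ∀ v, Γ.q v = 0) (v : V) :
    (Γ.canonicalCoeff v : ℝ) = Γ.valenceCoeff v := by
  simp [canonicalCoeff, hq, valenceCoeff]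

theorem evalDivisor_canonicalDivisor (hq : ∀ v, Γ.q v = 0) (f : Γ.Point → ℝ) :
    evalDivisor Γ.canonicalDivisor f = ∑ v, Γ.valenceCoeff v * f (.vert v) := by
  classical
  rw [evalDivisor, canonicalDivisor, ← Finsupp.sum_finsetSum_index]
  · refine Finset.sum_congr rfl fun v _ => ?_
    rw [Finsupp.sum_single_index (by simp), canonicalCoeff_of_q_eq_zero Γ hq]
  · simp
  · intros; push_cast; ring

theorem genus_eq_fosterSum (hq : ∀ v, Γ.q v = 0) : (Γ.genus : ℝ) = Γ.fosterSum := by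
  simp [genus, hq, firstBetti_eq, fosterSum, sum_foster]

/-- Eliminating τ leaves ε with coefficient $\frac{5g-2}{4(g-1)}$, and
$\epsilon=\frac{W}{2g}+\frac{(g-1)X}{3g}$. The terms in $W$, $X$ and θ match those of
$-\omega_1/\eta^2$; the length keeps the coefficient $-\frac14+\frac{5g-2}{12g}=\frac{g-1}{6g}$. -/
theorem phi_eq (hq : ∀ v, Γ.q v = 0) (hg : 2 ≤ Γ.genus) :
    Γ.phi = ((Γ.genus : ℝ) - 1) / (6 * Γ.genus) * Γ.totalLength - Γ.omega1 / Γ.eta ^ 2 := by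
  have hgF := Γ.genus_eq_fosterSum hq
  have hg2 : (2 : ℝ) ≤ Γ.genus := by exact_mod_cast hg
  have hF0 : Γ.fosterSum ≠ 0 := by rw [← hgF]; positivity
  have hF1 : Γ.fosterSum ≠ 1 := by rw [← hgF]; intro h; linarith
  have hD := Γ.evalDivisor_canonicalDivisor hq
  have hmu : Γ.mu = Γ.edgeDensity Γ.canonicalDensity := admissibleMeasure_canonical hF0 hF1 hD
  have hη := Γ.eta_pos.ne'
  set W := ∑ u, Γ.valenceCoeff u * ∑ e, Γ.foster e *
    (kernelResistance (G := Γ.toWeightedGraph) (.vert u) (.vert (Γ.src e)) +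
      kernelResistance (G := Γ.toWeightedGraph) (.vert u) (.vert (Γ.tgt e))) with hW
  set X := ∑ e, Γ.foster e ^ 2 * Γ.length e with hX
  set θ := ∑ u, ∑ v, Γ.valenceCoeff u * Γ.valenceCoeff v *
    kernelResistance (G := Γ.toWeightedGraph) (.vert u) (.vert v) with hθ
  set g : ℝ := (Γ.genus : ℝ) with hgdef
  have hε : (∑ v, Γ.valenceCoeff v * edgeIntegral Γ.canonicalDensity fun x : Γ.Point =>
      kernelResistance x (.vert v)) = g⁻¹ * (W / 2 + (2 * g - 2) * (X / 6)) := by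
    have h1 : ∀ v, Γ.valenceCoeff v * edgeIntegral Γ.canonicalDensity (fun x : Γ.Point =>
        kernelResistance x (.vert v)) = g⁻¹ / 2 * (Γ.valenceCoeff v * ∑ e, Γ.foster e *
          (kernelResistance (G := Γ.toWeightedGraph) (.vert v) (.vert (Γ.src e)) +
            kernelResistance (G := Γ.toWeightedGraph) (.vert v) (.vert (Γ.tgt e)))) +
          Γ.valenceCoeff v * (g⁻¹ * (X / 6)) := fun v => by
      rw [edgeIntegral_kernelResistance hF0, ← hgF, ← hX]; ring
    simp only [h1, Finset.sum_add_distrib, ← Finset.mul_sum, ← Finset.sum_mul, sum_valenceCoeff,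
      ← hW, ← hgF]
    ring
  have heps : Γ.epsilonInv = g⁻¹ * (W / 2 + (2 * g - 2) * (X / 6)) := by
    rw [← hε, epsilonInv, hmu]
    simp only [resistance_eq, hD]
    have hc : ∀ v : V, Continuous fun y : Γ.Point => kernelResistance (G := Γ.toWeightedGraph) (.vert v) y := fun v => by
      simp only [kernelResistance_comm (Point.vert v)]
      exact continuous_kernelResistance _
    rw [integral_edgeDensity_eq (by fun_prop), edgeIntegral_sum _ _ _ hc]
    simp only [kernelResistance_comm (Point.vert _)]
  have htau : 8 * g * (g - 1) * Γ.tauInv = (4 * g - 2) * Γ.epsilonInv - θ := by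
    obtain ⟨hc, h1⟩ := integral_kernelResistance hF0 hD
    rw [← hgF, hε, ← heps] at h1
    rw [← h1, tauInv, hmu]
    simp only [resistance_eq, integral_edgeDensity_eq (continuous_kernelResistance _)]
    rw [integral_edgeDensity_eq hc]
  have homega : Γ.omega1 / Γ.eta ^ 2 = (5 * g - 2) / (12 * g) * (Γ.totalLength - X) +
      3 * θ / (8 * (g - 1)) - (5 * g - 2) / (8 * g * (g - 1)) * W := by
    have hd : ∀ e, Γ.eta - Γ.etaResistance (Γ.src e) (Γ.tgt e) / Γ.length e =
        Γ.eta * Γ.foster e := fun e => by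
      rw [etaResistance, resistance_eq, foster_eq]; ring
    have h1 : ∑ e, (Γ.eta * Γ.foster e) ^ 2 * Γ.length e = Γ.eta ^ 2 * X := by
      rw [hX, Finset.mul_sum]; exact Finset.sum_congr rfl fun e _ => by ring
    have h2 : ∑ u, ∑ v, (Γ.canonicalCoeff u : ℝ) * Γ.etaResistance u v *
        (3 * g * Γ.canonicalCoeff v - 2 * (5 * g - 2) * (Γ.q v : ℝ)) = 3 * g * Γ.eta * θ := by
      rw [hθ, Finset.mul_sum]
      refine Finset.sum_congr rfl fun u _ => ?_
      rw [Finset.mul_sum]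
      refine Finset.sum_congr rfl fun v _ => ?_
      rw [etaResistance, resistance_eq, hq, canonicalCoeff_of_q_eq_zero Γ hq,
        canonicalCoeff_of_q_eq_zero Γ hq, Nat.cast_zero]
      ring
    have h3 : ∑ u, (Γ.canonicalCoeff u : ℝ) * ∑ e, Γ.eta * Γ.foster e *
        (Γ.etaResistance u (Γ.src e) + Γ.etaResistance u (Γ.tgt e)) = Γ.eta ^ 2 * W := by
      rw [hW, Finset.mul_sum]
      refine Finset.sum_congr rfl fun u _ => ?_
      have h4 : ∑ e, Γ.eta * Γ.foster e * (Γ.etaResistance u (Γ.src e) +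
          Γ.etaResistance u (Γ.tgt e)) = Γ.eta ^ 2 * ∑ e, Γ.foster e *
          (kernelResistance (G := Γ.toWeightedGraph) (.vert u) (.vert (Γ.src e)) +
            kernelResistance (G := Γ.toWeightedGraph) (.vert u) (.vert (Γ.tgt e))) := by
        rw [Finset.mul_sum]
        refine Finset.sum_congr rfl fun e _ => ?_
        rw [etaResistance, etaResistance, resistance_eq, resistance_eq]
        ring
      rw [canonicalCoeff_of_q_eq_zero Γ hq, h4]
      ring
    simp only [omega1, hd, h1, ← hgdef, h2, h3]
    have : g - 1 ≠ 0 := by linarith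
    field_simp
  have hg1 : g - 1 ≠ 0 := by linarith
  have hg0 : g ≠ 0 := by linarith
  have htau' : Γ.tauInv = ((4 * g - 2) * Γ.epsilonInv - θ) / (8 * g * (g - 1)) := by
    rw [eq_div_iff (by positivity), ← htau]; ring
  rw [phi, ← hgdef, htau', homega, heps]
  field_simp
  ring

end PMGraph

theorem mainTheorem8 {V E : Type*} [Fintype V] [Fintype E] (Γ : PMGraph V E) (g : ℕ)
    (hg : 2 ≤ g) (hgenus : Γ.genus = g) (hq : ∀ v, Γ.q v = 0)
    (hirr : Γ.IsIrreducible) (hcubic : Γ.IsCubic) (hcan : Γ.IsCanonicalModel)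
    (A : ℝ) (hA : 0 < A)
    (hbound : Γ.omega1 / Γ.eta ^ 2 ≤ A * (Γ.sigma 3 / Γ.sigma 2)) :
    Γ.phi ≥ (((g : ℝ) - 1) / (6 * g) - A * ((3 * g - 5) / (9 * ((g : ℝ) - 1)))) *
      Γ.totalLength := by
  subst hgenus
  have hval : ∀ v, Γ.vertexValence v = 3 := fun v => (hcan (.vert v)).1 ⟨v, rfl⟩
  have hg2 : (2 : ℝ) ≤ Γ.genus := by exact_mod_cast hg
  have hgF := Γ.genus_eq_fosterSum hq
  rw [WeightedGraph.fosterSum, WeightedGraph.sum_foster] at hgF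
  have h2m := WeightedGraph.sum_vertexValence (G := Γ.toWeightedGraph)
  simp only [hval, Finset.sum_const, Finset.card_univ, nsmul_eq_mul, Nat.cast_ofNat] at h2m
  -- Combine $3|V|=2|E|$ with $g=|E|-|V|+1$.
  have hm : (Fintype.card E : ℝ) = 3 * Γ.genus - 3 := by linarith
  have hE : 2 ≤ Fintype.card E := by
    have : (2 : ℝ) ≤ Fintype.card E := by linarith
    exact_mod_cast this
  have hσ2 := Γ.sigma_two_pos hE
  have hσ := Γ.card_mul_sigma_three_le
  rw [hm] at hσ
  have hg1 : (0 : ℝ) < Γ.genus - 1 := by linarith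
  -- With $m=3g-3$, the factors $m-2$ and $3m$ become $3g-5$ and $9(g-1)$.
  have hratio : Γ.sigma 3 / Γ.sigma 2 ≤
      (3 * Γ.genus - 5) / (9 * ((Γ.genus : ℝ) - 1)) * Γ.totalLength := by
    rw [div_le_iff₀ hσ2, div_mul_eq_mul_div, div_mul_eq_mul_div, le_div_iff₀ (by positivity)]
    linarith
  have h := hbound.trans (mul_le_mul_of_nonneg_left hratio hA.le)
  rw [Γ.phi_eq hq hg, ge_iff_le, sub_mul, mul_assoc A]
  linarith
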